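/- Let $P$ be the uniform distribution (normalized Lebesgue measure) on the equilateral triangle with vertices $O=(0,0)$, $A=(1,0)$ and $B=(\frac12,\frac{\sqrt3}{2})$ in $\mathbb R^2$. Let $$V_3(P)=\inf\Big\{\int \min_{a\in\alpha}\|x-a\|^2\,dP(x)\;:\;\alpha\subset\mathbb R^2,\ 1\le\operatorname{card}(\alpha)\le 3\Big\}$$ be its third quantization error, where $\|\cdot\|$ is the Euclidean norm, and call a nonempty set $\alpha\subset\mathbb R^2$ with at most three points an optimal set of three-means if it attains this infimum. Then the set $\{p,q,r\}$ with $$p=\Big(\tfrac{7}{24},\tfrac{7}{24\sqrt3}\Big),\qquad q=\Big(\tfrac{17}{24},\tfrac{7}{24\sqrt3}\Big),\qquad r=\Big(\tfrac12,\tfrac{11}{12\sqrt3}\Big)$$ is an optimal set of three-means for $P$, and it is the only one. The points $p,q,r$ are the vertices of a (nondegenerate) equilateral triangle whose sides are parallel to the sides of the original triangle: $pq\parallel OA$, $qr\parallel AB$ and $rp\parallel BO$. Moreover $V_3(P)=\frac{11}{432}$. -/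

import Mathlib

open MeasureTheory ProbabilityTheory
open scoped ENNReal Affine

namespace Quantization

/-- The Euclidean plane `ℝ²`. -/
abbrev Plane : Type := EuclideanSpace ℝ (Fin 2)

/-- The distortion `∫ min_{a ∈ α} ‖x - a‖² dP(x)` of a set `α` of points with respect to `P`,
as an extended nonnegative number (for `α = ∅` the minimum is `∞`; for a finite nonempty `α`
the infimum is a minimum). -/
noncomputable def distortion {d : ℕ} (P : Measure (EuclideanSpace ℝ (Fin d)))
    (α : Set (EuclideanSpace ℝ (Fin d))) : ℝ≥0∞ :=
  ∫⁻ x, ⨅ a ∈ α, ‖x - a‖ₑ ^ 2 ∂P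

/-- The `n`th quantization error `V_n(P)`: the infimum of the distortion over all sets `α` of at
most `n` points. -/
noncomputable def quantizationError {d : ℕ} (P : Measure (EuclideanSpace ℝ (Fin d)))
    (n : ℕ) : ℝ≥0∞ :=
  ⨅ (α : Set (EuclideanSpace ℝ (Fin d))) (_ : α.encard ≤ n), distortion P α

/-- `α` is an optimal set of `n`-means for `P`: it has at most `n` points and attains the infimum
that defines `V_n(P)`. -/
def IsOptimalSetOfMeans {d : ℕ} (P : Measure (EuclideanSpace ℝ (Fin d))) (n : ℕ)
    (α : Set (EuclideanSpace ℝ (Fin d))) : Prop :=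
  α.encard ≤ n ∧ distortion P α = quantizationError P n

/-- The vertex `(0, 0)`. -/
noncomputable def vertexO : Plane := !₂[0, 0]

/-- The vertex `(1, 0)`. -/
noncomputable def vertexA : Plane := !₂[1, 0]

/-- The vertex `(1/2, √3/2)`. -/
noncomputable def vertexB : Plane := !₂[1 / 2, √3 / 2]

/-- The (filled) equilateral triangle with vertices `(0, 0)`, `(1, 0)`, `(1/2, √3/2)`. -/
def triangle : Set Plane := convexHull ℝ {vertexO, vertexA, vertexB}

/-- The uniform distribution on the triangle: normalized Lebesgue measure,
`P(S) = λ(S ∩ triangle) / λ(triangle)`. -/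
noncomputable def uniformTriangle : Measure Plane :=
  ProbabilityTheory.cond volume triangle

/-- The point `(7/24, 7/(24√3))`. -/
noncomputable def meanP : Plane := !₂[7 / 24, 7 / (24 * √3)]

/-- The point `(17/24, 7/(24√3))`. -/
noncomputable def meanQ : Plane := !₂[17 / 24, 7 / (24 * √3)]

/-- The point `(1/2, 11/(12√3))`. -/
noncomputable def meanR : Plane := !₂[1 / 2, 11 / (12 * √3)]

end Quantization

/-! Let D be the mean squared distance of an optimal triple, V its circumcentre and S its squared
circumradius. Two stationarity identities carry the proof. Dilating the triple about a vertex of the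
triangle shows that the squared distance to the nearest point has mean 2D over the opposite edge
(`edge_mean_eq_two_mul`). Dilating it about V leaves the cells unchanged and gives D = 1/12 + |V -
centroid|² - S (`meanDistSq_eq_of_circumcenter`). Since the stated triple achieves at most 11/432,
the same bound holds for D. This forces S to be large, and it excludes collinear triples and triples
for which two vertices share a nearest point, so the three points can be labelled by the vertices.

Eliminating D between the identities gives, for each edge, the exact mean Q of max ⟨z - V, e - V⟩
over the edge, where e runs through the three points. Cauchy-Schwarz bounds Q from above. An edge
meeting all three cells would push V beyond that edge or beyond the opposite vertex, and the bounds
exclude both (`no_three_cell_edge`). On an edge with two cells, taking the angle into account gives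
a quadratic inequality in κ, which is √3 times the cotangent of the angle of the triple subtending
the two points. It implies κ ≥ (1 - 8x/3)/(1 + 16x/15) (`comparison_le_of_edge_quadratic`), where x
measures how far V lies towards the edge. The right side is tangent at x = 0 to the smaller root of
the quadratic at y = δ = 0.

The three x sum to 0, and the cotangent identity says that the pairwise products of the three κ sum
to 3. These facts are compatible only if all x vanish (`comparison_sum`). Then V is the centroid,
every κ is 1, the cells on the edge OA meet at its midpoint, and the coordinates follow
(`coords_of_equality`). A minimiser exists by compactness, so uniqueness also proves optimality.

Notation: for an edge with unit direction t and outward normal n, V = centroid + (√3/6)(y t + x n),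
so x = 1 is the line of the edge. Moreover w = x² + y², and δ is √3 times the offset of the break
point between two cells from the midpoint of the edge. -/

/-! ### Polynomial inequalities behind the lower bound for κ -/

/-- This is the edge quadratic at the comparison value of κ, with denominators cleared, Y = y², and
the terms in δ replaced by the lower bound of `break_contrib_neg`. Tangency at x = 0 is what makes
the part free of Y divisible by x². -/
theorem edge_poly_neg {x Y : ℝ} (hx : -(11/50) ≤ x) (hx0 : x ≤ 0) (hY : 0 ≤ Y) :
    0 ≤ (225 + 224*(x^2+Y) + 576*x^2 - 400*x) * ((1-8*x/3)^2 + 3*(1+16*x/15)^2)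
      - (1200+1728*(x^2+Y))*(1-x)*(1-8*x/3)*(1+16*x/15)
      + (1200+1728*(x^2+Y))*(1+16*x/15)^2*((x^2+Y)-2*x+1/4)
      - (1200+1728*(x^2+Y))*(1+16*x/15)*((13/25 + x/2)*Y) := by
  obtain ⟨s, rfl⟩ : ∃ s, x = -s := ⟨-x, by ring⟩
  have hs0 : 0 ≤ s := by linarith
  have hs1 : s ≤ 11/50 := by linarith
  -- The three coefficients of the polynomial in Y are rounded down to small integers.
  have h0 : 1760 + 4982*s + 6000*s^2 ≤ 1760 + 224192/45*s + 1525952/225*s^2 + 129024/25*s^3 + 49152/25*s^4 := by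
    have h3 : 0 ≤ s^3 := by positivity
    have h4 : 0 ≤ s^4 := by positivity
    nlinarith
  have h1 : 176 - 3492*s + 909*s^2 + 3297*s^3 ≤ 176 - 52376/15*s + 204608/225*s^2 + 412128/125*s^3 + 75264/25*s^4 := by
    have h3 : 0 ≤ s^3 := by positivity
    have h4 : 0 ≤ s^4 := by positivity
    nlinarith
  have h2 : 829 - 1864*s + 1044*s^2 ≤ 20736/25 - 232992/125*s + 26112/25*s^2 := by nlinarith
  have key : 0 ≤ s^2*(1760 + 4982*s + 6000*s^2) + Y*(176 - 3492*s + 909*s^2 + 3297*s^3)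
      + Y^2*(829 - 1864*s + 1044*s^2) := by
    rcases le_total s (1/20) with h | h
    · have : 0 ≤ 176 - 3492*s + 909*s^2 + 3297*s^3 := by nlinarith
      have : 0 ≤ 829 - 1864*s + 1044*s^2 := by nlinarith
      positivity
    -- The coefficient of Y may now be negative, so the discriminant in Y is used. Bounding that
    -- coefficient by 2350 s in absolute value lets the factor s² cancel.
    · have hp : 0 < 829 - 1864*s + 1044*s^2 := by nlinarith
      have hd : (176 - 3492*s + 909*s^2 + 3297*s^3)^2 ≤
          4*(829 - 1864*s + 1044*s^2)*(s^2*(1760 + 4982*s + 6000*s^2)) := by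
        have b1 : (2350:ℝ)^2 ≤ 4*(829 - 1864*s + 1044*s^2)*(1760 + 4982*s + 6000*s^2) := by
          nlinarith [mul_nonneg hs0 (sub_nonneg.2 hs1), mul_nonneg (mul_nonneg hs0 hs0) (sub_nonneg.2 hs1),
            mul_nonneg (mul_nonneg hs0 hs0) (mul_nonneg hs0 (sub_nonneg.2 hs1)), pow_nonneg hs0 4]
        have b2 : -(176 - 3492*s + 909*s^2 + 3297*s^3) ≤ 2350*s := by
          nlinarith [mul_nonneg hs0 (sub_nonneg.2 hs1), mul_nonneg (mul_nonneg hs0 hs0) (sub_nonneg.2 hs1), sub_nonneg.2 h, mul_nonneg (sub_nonneg.2 h) (sub_nonneg.2 hs1), mul_nonneg hs0 (mul_nonneg (sub_nonneg.2 h) (sub_nonneg.2 hs1))]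
        have b3 : 176 - 3492*s + 909*s^2 + 3297*s^3 ≤ 2350*s := by
          nlinarith [mul_nonneg hs0 (sub_nonneg.2 hs1), mul_nonneg (mul_nonneg hs0 hs0) (sub_nonneg.2 hs1)]
        calc (176 - 3492*s + 909*s^2 + 3297*s^3)^2 ≤ (2350*s)^2 := sq_le_sq' (by linarith) b3
          _ = 2350^2 * s^2 := by ring
          _ ≤ (4*(829 - 1864*s + 1044*s^2)*(1760 + 4982*s + 6000*s^2)) * s^2 :=
            mul_le_mul_of_nonneg_right b1 (sq_nonneg s)
          _ = _ := by ring
      have : 0 ≤ 4*(829 - 1864*s + 1044*s^2)*(s^2*(1760 + 4982*s + 6000*s^2) + Y*(176 - 3492*s + 909*s^2 + 3297*s^3)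
      + Y^2*(829 - 1864*s + 1044*s^2)) := by
        nlinarith [sq_nonneg (2*(829 - 1864*s + 1044*s^2)*Y + (176 - 3492*s + 909*s^2 + 3297*s^3))]
      exact nonneg_of_mul_nonneg_right this (by linarith)
  have e : (225 + 224*((-s)^2+Y) + 576*(-s)^2 - 400*(-s)) * ((1-8*(-s)/3)^2 + 3*(1+16*(-s)/15)^2)
      - (1200+1728*((-s)^2+Y))*(1-(-s))*(1-8*(-s)/3)*(1+16*(-s)/15)
      + (1200+1728*((-s)^2+Y))*(1+16*(-s)/15)^2*(((-s)^2+Y)-2*(-s)+1/4)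
      - (1200+1728*((-s)^2+Y))*(1+16*(-s)/15)*((13/25 + (-s)/2)*Y)
      = s^2*(1760 + 224192/45*s + 1525952/225*s^2 + 129024/25*s^3 + 49152/25*s^4)
       + Y*(176 - 52376/15*s + 204608/225*s^2 + 412128/125*s^3 + 75264/25*s^4)
       + Y^2*(20736/25 - 232992/125*s + 26112/25*s^2) := by ring
  rw [e]
  have := mul_le_mul_of_nonneg_left h0 (sq_nonneg s)
  have := mul_le_mul_of_nonneg_left h1 hY
  have := mul_le_mul_of_nonneg_left h2 (sq_nonneg Y)
  linarith

/-- The counterpart of `edge_poly_neg` for x ≥ 0. On this range all coefficients of the polynomial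
in Y are nonnegative. -/
theorem edge_poly_pos {x Y : ℝ} (hx0 : 0 ≤ x) (hx : x ≤ 11/25) (hY : 0 ≤ Y) :
    0 ≤ (225 + 224*(x^2+Y) + 576*x^2 - 400*x) * ((1-8*x/3)^2 + 3*(1+16*x/15)^2)
      - (1200+1728*(x^2+Y))*(1-x)*(1-8*x/3)*(1+16*x/15)
      + (1200+1728*(x^2+Y))*(1+16*x/15)^2*((x^2+Y)-2*x+1/4)
      - (1200+1728*(x^2+Y))*(1+16*x/15)*((13/25 + 3*x/2)*Y) := by
  have h0 : 0 ≤ 1760 - 224192/45*x + 1525952/225*x^2 - 129024/25*x^3 + 49152/25*x^4 := by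
    have : 0 ≤ 1760 - 224192/45*x + 1525952/225*x^2 - 129024/25*x^3 := by
      nlinarith [sq_nonneg (x - 11/25), mul_nonneg hx0 (sq_nonneg (x - 11/25)),
        mul_nonneg hx0 (sub_nonneg.2 hx), mul_nonneg (mul_nonneg hx0 hx0) (sub_nonneg.2 hx)]
    positivity
  have h1 : 0 ≤ 176 + 34376/15*x - 83392/225*x^2 - 628128/125*x^3 + 29184/25*x^4 := by
    nlinarith [mul_nonneg hx0 (sub_nonneg.2 hx), mul_nonneg (mul_nonneg hx0 hx0) (sub_nonneg.2 hx),
      pow_nonneg hx0 4]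
  have h2 : 0 ≤ 20736/25 + 16992/125*x - 19968/25*x^2 := by nlinarith
  have e : (225 + 224*(x^2+Y) + 576*x^2 - 400*x) * ((1-8*x/3)^2 + 3*(1+16*x/15)^2)
      - (1200+1728*(x^2+Y))*(1-x)*(1-8*x/3)*(1+16*x/15)
      + (1200+1728*(x^2+Y))*(1+16*x/15)^2*((x^2+Y)-2*x+1/4)
      - (1200+1728*(x^2+Y))*(1+16*x/15)*((13/25 + 3*x/2)*Y)
      = x^2*(1760 - 224192/45*x + 1525952/225*x^2 - 129024/25*x^3 + 49152/25*x^4)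
       + Y*(176 + 34376/15*x - 83392/225*x^2 - 628128/125*x^3 + 29184/25*x^4)
       + Y^2*(20736/25 + 16992/125*x - 19968/25*x^2) := by ring
  rw [e]
  positivity

/-- the contribution of the break point `δ` -/
theorem break_contrib_neg {x y δ : ℝ} (hx : -(11/50) ≤ x) (hx0 : x ≤ 0) (hy : y^2 ≤ 121/625)
    (hδ : δ^2 ≤ 37/100) :
    -((13/25 + x/2)*y^2) ≤ (1+16*x/15)*(2*(δ*(δ-y)) - 4/3*(δ*(δ-y))^2)
      + 4/3*(1-x)*δ^2*((1-8*x/3) - (1-x)*(1+16*x/15)) := by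
  have hA : 0 < 1+16*x/15 := by linarith
  have hg : 0 ≤ 4/3*(1-x)*δ^2*((1-8*x/3) - (1-x)*(1+16*x/15)) := by
    have h1 : 0 ≤ (1-8*x/3) - (1-x)*(1+16*x/15) := by nlinarith
    have h2 : 0 ≤ 1 - x := by linarith
    positivity
  have hy' : |y| ≤ 11/25 := by
    apply abs_le_of_sq_le_sq <;> norm_num; linarith
  have hδ' : |δ| ≤ 61/100 := by
    apply abs_le_of_sq_le_sq <;> norm_num; linarith
  have he : -(1/4*y^2) ≤ δ*(δ-y) := by nlinarith [sq_nonneg (δ - y/2)]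
  have he2 : δ*(δ-y) ≤ 1 := by
    have : -(δ*y) ≤ |δ| * |y| := by rw [← abs_mul]; exact neg_le_abs _
    nlinarith [abs_nonneg δ, abs_nonneg y]
  -- For e = δ(δ - y) ≥ -y²/4, the left side of the worst case is -(1/2 + y²/12) y², and 13/25
  -- rounds up 1/2 + 121/7500.
  have h3 : -(13/25*y^2) ≤ 2*(δ*(δ-y)) - 4/3*(δ*(δ-y))^2 := by
    rcases le_total 0 (δ*(δ-y)) with h | h
    · nlinarith [sq_nonneg y]
    · nlinarith [sq_nonneg y]
  have h4 : -((13/25 + x/2)*y^2) ≤ (1+16*x/15) * (-(13/25*y^2)) := by nlinarith [sq_nonneg y, mul_nonneg (neg_nonneg.2 hx0) (sq_nonneg y)]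
  nlinarith [mul_le_mul_of_nonneg_left h3 hA.le]

theorem break_contrib_pos {x y δ : ℝ} (hx0 : 0 ≤ x) (hx : x ≤ 11/25) (hy : y^2 ≤ 121/625)
    (hδ : δ^2 ≤ 37/100) :
    -((13/25 + 3*x/2)*y^2) ≤ (1+16*x/15)*(2*(δ*(δ-y)) - 4/3*(δ*(δ-y))^2)
      + 4/3*(1-x)*δ^2*((1-8*x/3) - (1-x)*(1+16*x/15)) := by
  have hA : 0 < 1+16*x/15 := by linarith
  have hy' : |y| ≤ 11/25 := by
    apply abs_le_of_sq_le_sq <;> norm_num; linarith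
  have hδ' : |δ| ≤ 61/100 := by
    apply abs_le_of_sq_le_sq <;> norm_num; linarith
  have he : -(1/4*y^2) ≤ δ*(δ-y) := by nlinarith [sq_nonneg (δ - y/2)]
  have he2 : δ*(δ-y) ≤ 64/100 := by
    have : -(δ*y) ≤ |δ| * |y| := by rw [← abs_mul]; exact neg_le_abs _
    nlinarith [abs_nonneg δ, abs_nonneg y]
  set g := 4/3*(1-x)*x*(41-16*x)/15 with hg
  have hgd : 4/3*(1-x)*δ^2*((1-8*x/3) - (1-x)*(1+16*x/15)) = -(g*δ^2) := by rw [hg]; ring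
  have hg0 : 0 ≤ g := by
    rw [hg]; have : 0 ≤ 1 - x := by linarith
    have : 0 ≤ 41-16*x := by linarith
    positivity
  rw [hgd]
  have hg1 : 2*g ≤ 57/50*(1+16*x/15) := by rw [hg]; nlinarith [sq_nonneg (x-2/5), mul_nonneg hx0 (sq_nonneg (x-2/5)), mul_nonneg hx0 (sub_nonneg.2 hx)]
  have hg2 : g ≤ 13/25 + 3*x/2 := by
    rw [hg]; nlinarith [sq_nonneg (x - 6/25), mul_nonneg (mul_nonneg hx0 hx0) (sub_nonneg.2 hx)]
  -- With e = δ(δ - y), the concave function 2e - 4e²/3 is bounded below by a line through 0: slope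
  -- 57/50 for 0 ≤ e ≤ 64/100, and slope 207/100 for negative e ≥ -y²/4. What remains is a quadratic
  -- form in δ and y.
  rcases le_total 0 (δ*(δ-y)) with h | h
  · have h3 : 57/50*(δ*(δ-y)) ≤ 2*(δ*(δ-y)) - 4/3*(δ*(δ-y))^2 := by nlinarith
    have h4 := mul_le_mul_of_nonneg_left h3 hA.le
    have h5 : 2*g*(δ*(δ-y)) ≤ (1+16*x/15)*(57/50*(δ*(δ-y))) := by nlinarith
    nlinarith [mul_nonneg hg0 (sq_nonneg (δ-y)), mul_le_mul_of_nonneg_right hg2 (sq_nonneg y)]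
  · have h3 : 207/100*(δ*(δ-y)) ≤ 2*(δ*(δ-y)) - 4/3*(δ*(δ-y))^2 := by nlinarith
    have h4 := mul_le_mul_of_nonneg_left h3 hA.le
    have hp : 0 < 207/100*(1+16*x/15) - g := by nlinarith
    have hd : (207/100*(1+16*x/15))^2 ≤ 4*(207/100*(1+16*x/15) - g)*(13/25+3*x/2) := by
      have h8 : 0 ≤ x^3*(11/25 - x) := mul_nonneg (by positivity) (by linarith)
      have h9 : 0 ≤ x*(x - 3/50)^2 := by positivity
      have e : 4*(207/100*(1+16*x/15) - g)*(13/25+3*x/2) - (207/100*(1+16*x/15))^2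
          = 207/10000 + 16373/56250*x - 46176/15625*x^2 + 30872/1125*x^3 - 128/15*x^4 := by
        rw [hg]; ring_nf
      nlinarith
    have h6 : 0 ≤ 4*(207/100*(1+16*x/15) - g)*((207/100*(1+16*x/15) - g)*δ^2 - 207/100*(1+16*x/15)*(δ*y) + (13/25+3*x/2)*y^2) := by
      nlinarith [sq_nonneg (2*(207/100*(1+16*x/15) - g)*δ - 207/100*(1+16*x/15)*y), mul_le_mul_of_nonneg_right hd (sq_nonneg y)]
    have h7 := nonneg_of_mul_nonneg_right h6 (by linarith)
    linarith

theorem edge_slope_one_var {x : ℝ} (hx : -(11/50) ≤ x) (hx' : x ≤ 11/25) :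
    2*(225+800*x^2-400*x)*(1-8*x/3) - (1200+1728*x^2)*(1-x)*(1+16*x/15)
      + 4*(1-x)*(1+16*x/15)*(75-368*x^2+400*x) ≤ 0 := by
  have hp : 0 ≤ (x + 11/50)*(11/25 - x) := mul_nonneg (by linarith) (by linarith)
  have h6 : (10240/3)*x^2 - (18560/3)*x ≤ 1527 := by nlinarith
  have h7 := mul_le_mul_of_nonneg_right h6 (sq_nonneg x)
  have h8 : -450 - 460*x + 3127*x^2 ≤ 0 := by nlinarith
  linarith

theorem edge_lead_pos {x w : ℝ} (h : x^2 ≤ w) : 0 < 225 + 224*w + 576*x^2 - 400*x := by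
  nlinarith [sq_nonneg (x - 1/4)]

theorem break_point_sq_le {x w t : ℝ} (hw0 : 0 ≤ w)
    (h : (1200 + 1728*w) * t ≤ 3*(75 + 208*w - 576*x^2 + 400*x)) : t ≤ 37/100 := by
  by_contra! h'
  have h1 : (1200 + 1728*w) * (37/100) < (1200 + 1728*w) * t :=
    mul_lt_mul_of_pos_left h' (by positivity)
  nlinarith [sq_nonneg (x - 7/20)]

/-- The quadratic polynomial in `κ` attached to an edge is positive below the comparison value. -/
theorem comparison_le_of_edge_quadratic {x y δ κ : ℝ} (hx : -(11/50) ≤ x) (hx' : x ≤ 11/25)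
    (hw : x^2 + y^2 ≤ 121/625)
    (hδ : (1200 + 1728*(x^2+y^2)) * δ^2 ≤ 3*(75 + 208*(x^2+y^2) - 576*x^2 + 400*x))
    (hψ : (225 + 224*(x^2+y^2) + 576*x^2 - 400*x) * (κ^2 + 3)
      - (1200+1728*(x^2+y^2))*(1-x)*(1-4/3*δ^2)*κ
      + (1200+1728*(x^2+y^2))*((x^2+y^2)-2*x+1-3/4*(1-4/3*(δ*(δ-y)))^2-4/3*(1-x)^2*δ^2) ≤ 0) :
    1 - 8*x/3 ≤ κ * (1+16*x/15) := by
  by_contra! hκ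
  have hA : 0 < 1+16*x/15 := by linarith
  have hy : y^2 ≤ 121/625 := by nlinarith [sq_nonneg x]
  have hδ2 : δ^2 ≤ 37/100 := break_point_sq_le (by positivity) hδ
  set w := x^2 + y^2 with hwdef
  have hxw : x^2 ≤ w := by rw [hwdef]; nlinarith [sq_nonneg y]
  have hw0 : 0 ≤ w := by positivity
  set a := 225 + 224*w + 576*x^2 - 400*x with ha
  set R := 1200 + 1728*w with hR
  have ha0 : 0 < a := edge_lead_pos hxw
  have hR0 : 0 < R := by positivity
  -- value at the comparison point
  have hT : 0 ≤ a*((1-8*x/3)^2 + 3*(1+16*x/15)^2) - R*(1-x)*(1-4/3*δ^2)*(1-8*x/3)*(1+16*x/15)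
      + R*(w-2*x+1-3/4*(1-4/3*(δ*(δ-y)))^2-4/3*(1-x)^2*δ^2)*(1+16*x/15)^2 := by
    have hsplit : a*((1-8*x/3)^2 + 3*(1+16*x/15)^2) - R*(1-x)*(1-4/3*δ^2)*(1-8*x/3)*(1+16*x/15)
      + R*(w-2*x+1-3/4*(1-4/3*(δ*(δ-y)))^2-4/3*(1-x)^2*δ^2)*(1+16*x/15)^2
      = (a*((1-8*x/3)^2 + 3*(1+16*x/15)^2) - R*(1-x)*(1-8*x/3)*(1+16*x/15)
      + R*(1+16*x/15)^2*(w-2*x+1/4)) + R*(1+16*x/15)*((1+16*x/15)*(2*(δ*(δ-y)) - 4/3*(δ*(δ-y))^2)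
      + 4/3*(1-x)*δ^2*((1-8*x/3) - (1-x)*(1+16*x/15))) := by ring
    rw [hsplit]
    have hRA : 0 ≤ R*(1+16*x/15) := by positivity
    rcases le_total x 0 with hx0 | hx0
    · have h1 := edge_poly_neg hx hx0 (sq_nonneg y)
      have h2 := mul_le_mul_of_nonneg_left (break_contrib_neg hx hx0 hy hδ2) hRA
      rw [← hwdef, ← hR, ← ha] at h1
      linarith
    · have h1 := edge_poly_pos hx0 hx' (sq_nonneg y)
      have h2 := mul_le_mul_of_nonneg_left (break_contrib_pos hx0 hx' hy hδ2) hRA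
      rw [← hwdef, ← hR, ← ha] at h1
      linarith
  -- slope at the comparison point
  have hS : 2*a*(1-8*x/3) - R*(1-x)*(1-4/3*δ^2)*(1+16*x/15) ≤ 0 := by
    have h0 : 0 ≤ 4/3*(1-x)*(1+16*x/15) := by
      have : 0 ≤ 1 - x := by linarith
      positivity
    have h1 := mul_le_mul_of_nonneg_left hδ h0
    have h2 : 2*a*(1-8*x/3) - R*(1-x)*(1+16*x/15)
        + 4/3*(1-x)*(1+16*x/15)*(3*(75 + 208*w - 576*x^2 + 400*x)) ≤ 0 := by
      have h3 : 448*(1-8*x/3) - 896*(1-x)*(1+16*x/15) ≤ 0 := by nlinarith [sq_nonneg x]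
      have h4 := mul_nonneg (neg_nonneg.2 h3) (sub_nonneg.2 hxw)
      have e : 2*a*(1-8*x/3) - R*(1-x)*(1+16*x/15)
        + 4/3*(1-x)*(1+16*x/15)*(3*(75 + 208*w - 576*x^2 + 400*x))
        = (448*(1-8*x/3) - 896*(1-x)*(1+16*x/15))*(w - x^2)
          + (2*(225+800*x^2-400*x)*(1-8*x/3) - (1200+1728*x^2)*(1-x)*(1+16*x/15)
           + 4*(1-x)*(1+16*x/15)*(75-368*x^2+400*x)) := by rw [ha, hR]; ring
      have h5 : 2*(225+800*x^2-400*x)*(1-8*x/3) - (1200+1728*x^2)*(1-x)*(1+16*x/15)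
           + 4*(1-x)*(1+16*x/15)*(75-368*x^2+400*x) ≤ 0 := edge_slope_one_var hx hx'
      linarith
    linarith
  -- Taylor expansion at the comparison value: for a positive gap m, the quadratic is a nonnegative
  -- value, plus m times a nonnegative number, plus a m² > 0.
  set m := (1-8*x/3) - κ*(1+16*x/15) with hm
  have hm0 : 0 < m := by rw [hm]; linarith
  have key : ((225 + 224*w + 576*x^2 - 400*x) * (κ^2 + 3)
      - R*(1-x)*(1-4/3*δ^2)*κ
      + R*(w-2*x+1-3/4*(1-4/3*(δ*(δ-y)))^2-4/3*(1-x)^2*δ^2)) * (1+16*x/15)^2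
      = (a*((1-8*x/3)^2 + 3*(1+16*x/15)^2) - R*(1-x)*(1-4/3*δ^2)*(1-8*x/3)*(1+16*x/15)
      + R*(w-2*x+1-3/4*(1-4/3*(δ*(δ-y)))^2-4/3*(1-x)^2*δ^2)*(1+16*x/15)^2)
      - m * (2*a*(1-8*x/3) - R*(1-x)*(1-4/3*δ^2)*(1+16*x/15)) + a*m^2 := by
    rw [hm, ha]; ring
  have h1 := mul_nonpos_of_nonpos_of_nonneg hψ (sq_nonneg (1+16*x/15))
  rw [key] at h1
  have h2 : 0 < a*m^2 := by positivity
  have h3 := mul_nonneg hm0.le (neg_nonneg.2 hS)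
  linarith

/-! ### Bounds on the position of the circumcentre -/

theorem normal_coord_ge {x₁ x₂ x₃ w : ℝ} (hs : x₁ + x₂ + x₃ = 0)
    (hw : w = 2/3*(x₁^2 + x₂^2 + x₃^2))
    (h₁ : 576*x₁^2 - 400*x₁ ≤ 75 + 208*w) (h₂ : 576*x₂^2 - 400*x₂ ≤ 75 + 208*w)
    (h₃ : 576*x₃^2 - 400*x₃ ≤ 75 + 208*w) (h12 : x₁ ≤ x₂) (h23 : x₂ ≤ x₃) :
    -(11/50) ≤ x₁ := by
  obtain ⟨m, rfl⟩ : ∃ m, x₁ = -m := ⟨-x₁, by ring⟩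
  obtain rfl : x₂ = m - x₃ := by linarith
  have hw' : w = 4/3*(m^2 + x₃^2 - m*x₃) := by rw [hw]; ring
  have hm : 0 ≤ m := by linarith
  have hM0 : m ≤ 2*x₃ := by linarith
  have hM : x₃ ≤ 2*m := by linarith
  by_contra! hlt
  have hm1 : 11/50 < m := by linarith
  -- Since x₃ ≤ 2m, w ≤ 4m² and `h₁` becomes 256m² - 400m + 75 ≥ 0, whose roots are about 0.218 and
  -- 1.345. The smaller root is the source of 11/50.
  have hm2 : 134/100 < m := by
    by_contra! h
    have : x₃^2 - m*x₃ ≤ 2*m^2 := by nlinarith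
    nlinarith
  -- Below this ratio 208w is less than 576m², so `h₁` would make m small. At or above it, x₃ is so
  -- large that `h₃` fails.
  have h5 : 165/100*m ≤ x₃ := by
    by_contra! h
    have : x₃^2 - m*x₃ ≤ 429/400*m^2 := by nlinarith
    nlinarith
  nlinarith

theorem coords_bound {x₁ x₂ x₃ w : ℝ} (hs : x₁ + x₂ + x₃ = 0)
    (hw : w = 2/3*(x₁^2 + x₂^2 + x₃^2))
    (h₁ : 576*x₁^2 - 400*x₁ ≤ 75 + 208*w) (h₂ : 576*x₂^2 - 400*x₂ ≤ 75 + 208*w)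
    (h₃ : 576*x₃^2 - 400*x₃ ≤ 75 + 208*w) :
    -(11/50) ≤ x₁ ∧ -(11/50) ≤ x₂ ∧ -(11/50) ≤ x₃ := by
  rcases le_total x₁ x₂ with a | a <;> rcases le_total x₂ x₃ with b | b <;>
    rcases le_total x₁ x₃ with c | c
  · have := normal_coord_ge hs hw h₁ h₂ h₃ a b; exact ⟨this, by linarith, by linarith⟩
  · have := normal_coord_ge hs hw h₁ h₂ h₃ a b; exact ⟨this, by linarith, by linarith⟩
  · have := normal_coord_ge (by linarith) (by linarith) h₁ h₃ h₂ c b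
    exact ⟨this, by linarith, by linarith⟩
  · have := normal_coord_ge (by linarith) (by linarith) h₃ h₁ h₂ c a
    exact ⟨by linarith, by linarith, this⟩
  · have := normal_coord_ge (by linarith) (by linarith) h₂ h₁ h₃ a c
    exact ⟨by linarith, this, by linarith⟩
  · have := normal_coord_ge (by linarith) (by linarith) h₂ h₃ h₁ b c
    exact ⟨by linarith, this, by linarith⟩
  · have := normal_coord_ge (by linarith) (by linarith) h₃ h₂ h₁ b a
    exact ⟨by linarith, by linarith, this⟩
  · have := normal_coord_ge (by linarith) (by linarith) h₃ h₂ h₁ b a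
    exact ⟨by linarith, by linarith, this⟩

/-- A convex function on the triangle cut out by the three lower bounds is largest at a corner, here
(-11/50, -11/50, 11/25). -/
theorem coord_energy_le {x₁ x₂ x₃ : ℝ} (hs : x₁ + x₂ + x₃ = 0)
    (h₁ : -(11/50) ≤ x₁) (h₂ : -(11/50) ≤ x₂) (h₃ : -(11/50) ≤ x₃) :
    2/3*(x₁^2 + x₂^2 + x₃^2) ≤ 121/625 := by
  obtain rfl : x₃ = -x₁ - x₂ := by linarith
  nlinarith [mul_nonneg (by linarith : 0 ≤ x₁ + 11/50) (by linarith : 0 ≤ x₂ + 11/50),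
    mul_nonneg (by linarith : 0 ≤ x₁ + 11/50) (by linarith : 0 ≤ -x₁ - x₂ + 11/50),
    mul_nonneg (by linarith : 0 ≤ x₂ + 11/50) (by linarith : 0 ≤ -x₁ - x₂ + 11/50)]

/-- The configuration in which an edge meets all three cells, seen from a circumcentre beyond
that edge. -/
theorem no_three_cells_beyond_edge {x₀ x₁ x₂ w : ℝ} (hs : x₀ + x₁ + x₂ = 0)
    (hw : w = 2/3*(x₀^2 + x₁^2 + x₂^2))
    (h₀ : 576*x₀^2 - 400*x₀ ≤ 1175/9 + 288*w) (h₁ : 576*x₁^2 - 400*x₁ ≤ 75 + 208*w)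
    (h₂ : 576*x₂^2 - 400*x₂ ≤ 75 + 208*w) (hx : 1 ≤ x₀) : False := by
  wlog h12 : x₁ ≤ x₂ generalizing x₁ x₂
  · exact this (by linarith) (by linarith) h₂ h₁ (by linarith)
  obtain ⟨m, rfl⟩ : ∃ m, x₁ = -m := ⟨-x₁, by ring⟩
  obtain rfl : x₂ = m - x₀ := by linarith
  have hw' : w = 4/3*(m^2 + x₀^2 - m*x₀) := by rw [hw]; ring
  have hm : x₀ ≤ 2*m := by linarith
  clear hw h₂ hs
  subst hw'
  have hm1 : 1/2 ≤ m := by linarith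
  have h5 : 165/100*m ≤ x₀ := by
    by_contra! h
    have : x₀^2 - m*x₀ ≤ 429/400*m^2 := by nlinarith
    nlinarith
  have hm2 : m ≤ 11/10 := by
    by_contra! h
    nlinarith
  have : x₀^2 - m*x₀ ≤ 2*m^2 := by nlinarith
  nlinarith

/-- The same configuration, seen from a circumcentre beyond the opposite vertex. -/
theorem no_three_cells_beyond_vertex {x₀ x₁ x₂ w : ℝ} (hs : x₀ + x₁ + x₂ = 0)
    (hw : w = 2/3*(x₀^2 + x₁^2 + x₂^2))
    (h₀ : 576*x₀^2 - 400*x₀ ≤ 1175/9 + 288*w) (hx₁ : 1 ≤ x₁) (hx₂ : 1 ≤ x₂) : False := by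
  obtain rfl : x₀ = -x₁ - x₂ := by linarith
  rw [hw] at h₀
  nlinarith [mul_nonneg (sub_nonneg.2 hx₁) (sub_nonneg.2 hx₂)]

/-! ### The three lower bounds for κ against the cotangent identity -/

theorem pair_product_clear {A₁ A₂ A₃ B₁ B₂ B₃ l₁ l₂ l₃ : ℝ} (h₁ : l₁ * A₁ = B₁)
    (h₂ : l₂ * A₂ = B₂) (h₃ : l₃ * A₃ = B₃) :
    (l₁*l₂ + l₂*l₃ + l₃*l₁) * (A₁*A₂*A₃) = B₁*B₂*A₃ + B₂*B₃*A₁ + B₃*B₁*A₂ := by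
  subst h₁ h₂ h₃; ring

theorem mul_mul_add_le_of_nonneg {u v : ℝ} (hu : 0 ≤ u) (hv : 0 ≤ v) (h : u + v ≤ 11/50) :
    u*v*(u+v) ≤ 11/150*(u^2 + u*v + v^2) := by
  have h1 : u*v ≤ (u^2 + u*v + v^2)/3 := by nlinarith [sq_nonneg (u - v)]
  have h2 : 0 ≤ u*v := by positivity
  nlinarith

/-- The left side is positive only if two of x₁, x₂, -(x₁+x₂) are nonnegative. Their sum is then
minus the third number, hence at most 11/50, and `mul_mul_add_le_of_nonneg` applies to them. -/
theorem mul_mul_add_le {x₁ x₂ : ℝ} (h₁ : -(11/50) ≤ x₁) (h₂ : -(11/50) ≤ x₂)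
    (h : x₁ + x₂ ≤ 11/50) : x₁*x₂*(x₁+x₂) ≤ 11/150*(x₁^2 + x₁*x₂ + x₂^2) := by
  have hq : 0 ≤ x₁^2 + x₁*x₂ + x₂^2 := by nlinarith [sq_nonneg (x₁ + x₂)]
  rcases le_total 0 x₁ with a | a <;> rcases le_total 0 x₂ with b | b
  · exact mul_mul_add_le_of_nonneg a b h
  · rcases le_total 0 (x₁ + x₂) with c | c
    · have := mul_nonneg (mul_nonneg a (neg_nonneg.2 b)) c
      nlinarith
    · have := mul_mul_add_le_of_nonneg a (neg_nonneg.2 c) (by linarith)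
      nlinarith
  · rcases le_total 0 (x₁ + x₂) with c | c
    · have := mul_nonneg (mul_nonneg (neg_nonneg.2 a) b) c
      nlinarith
    · have := mul_mul_add_le_of_nonneg b (neg_nonneg.2 c) (by linarith)
      nlinarith
  · have := mul_nonneg (mul_nonneg (neg_nonneg.2 a) (neg_nonneg.2 b)) (by linarith : 0 ≤ -(x₁+x₂))
    nlinarith

/-- The sum of pairwise products is monotone above the comparison values because these have positive
pairwise sums, so it is at most 3 at the comparison values. With denominators cleared this is a
positive definite quadratic form minus a cubic term, and the coordinates are too small for the cubic
term to compensate. -/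
theorem comparison_sum {x₁ x₂ x₃ κ₁ κ₂ κ₃ : ℝ} (hs : x₁ + x₂ + x₃ = 0)
    (hx₁ : -(11/50) ≤ x₁) (hx₂ : -(11/50) ≤ x₂) (hx₃ : -(11/50) ≤ x₃)
    (h₁ : 1 - 8*x₁/3 ≤ κ₁*(1+16*x₁/15)) (h₂ : 1 - 8*x₂/3 ≤ κ₂*(1+16*x₂/15))
    (h₃ : 1 - 8*x₃/3 ≤ κ₃*(1+16*x₃/15)) (hκ : κ₁*κ₂ + κ₂*κ₃ + κ₃*κ₁ = 3) :
    x₁ = 0 ∧ x₂ = 0 ∧ x₃ = 0 := by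
  have A₁ : 0 < 1+16*x₁/15 := by linarith
  have A₂ : 0 < 1+16*x₂/15 := by linarith
  have A₃ : 0 < 1+16*x₃/15 := by linarith
  have pair : ∀ {x y : ℝ}, -(11/50) ≤ x → -(11/50) ≤ y → x + y ≤ 11/50 →
      0 < (1 - 8*x/3)*(1+16*y/15) + (1 - 8*y/3)*(1+16*x/15) := by
    intro x y hx hy hxy
    nlinarith [sq_nonneg (x - y), mul_nonneg (by linarith : 0 ≤ x + 11/50) (by linarith : 0 ≤ y + 11/50)]
  have p12 := pair hx₁ hx₂ (by linarith)
  have p23 := pair hx₂ hx₃ (by linarith)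
  have p31 := pair hx₃ hx₁ (by linarith)
  set l₁ := (1 - 8*x₁/3)/(1+16*x₁/15) with hl₁
  set l₂ := (1 - 8*x₂/3)/(1+16*x₂/15) with hl₂
  set l₃ := (1 - 8*x₃/3)/(1+16*x₃/15) with hl₃
  have k₁ : l₁ ≤ κ₁ := by rw [hl₁, div_le_iff₀ A₁]; exact h₁
  have k₂ : l₂ ≤ κ₂ := by rw [hl₂, div_le_iff₀ A₂]; exact h₂
  have k₃ : l₃ ≤ κ₃ := by rw [hl₃, div_le_iff₀ A₃]; exact h₃
  have q12 : 0 < l₁ + l₂ := by rw [hl₁, hl₂, div_add_div _ _ A₁.ne' A₂.ne']; apply div_pos <;> nlinarith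
  have q23 : 0 < l₂ + l₃ := by rw [hl₂, hl₃, div_add_div _ _ A₂.ne' A₃.ne']; apply div_pos <;> nlinarith
  have q31 : 0 < l₃ + l₁ := by rw [hl₃, hl₁, div_add_div _ _ A₃.ne' A₁.ne']; apply div_pos <;> nlinarith
  have hl : l₁*l₂ + l₂*l₃ + l₃*l₁ ≤ 3 := by
    rw [← hκ]
    -- The difference of the two sums is ∑ (κᵢ - lᵢ)(lⱼ + lₖ) + ∑ (κᵢ - lᵢ)(κⱼ - lⱼ).
    nlinarith [mul_nonneg (sub_nonneg.2 k₁) q23.le, mul_nonneg (sub_nonneg.2 k₂) q31.le,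
      mul_nonneg (sub_nonneg.2 k₃) q12.le, mul_nonneg (sub_nonneg.2 k₁) (sub_nonneg.2 k₂),
      mul_nonneg (sub_nonneg.2 k₂) (sub_nonneg.2 k₃), mul_nonneg (sub_nonneg.2 k₃) (sub_nonneg.2 k₁)]
  have hclear : (l₁*l₂ + l₂*l₃ + l₃*l₁) * ((1+16*x₁/15)*(1+16*x₂/15)*(1+16*x₃/15)) =
      (1 - 8*x₁/3)*(1 - 8*x₂/3)*(1+16*x₃/15) + (1 - 8*x₂/3)*(1 - 8*x₃/3)*(1+16*x₁/15)
      + (1 - 8*x₃/3)*(1 - 8*x₁/3)*(1+16*x₂/15) := by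
    rw [pair_product_clear (div_mul_cancel₀ _ A₁.ne') (div_mul_cancel₀ _ A₂.ne') (div_mul_cancel₀ _ A₃.ne')]
  have hle := mul_le_mul_of_nonneg_right hl (by positivity : 0 ≤ (1+16*x₁/15)*(1+16*x₂/15)*(1+16*x₃/15))
  rw [hclear] at hle
  obtain rfl : x₃ = -x₁ - x₂ := by linarith
  have hfin : (x₁^2 + x₁*x₂ + x₂^2) - 48/5*(x₁*x₂*(x₁+x₂)) ≤ 0 := by
    clear_value l₁ l₂ l₃; linarith
  have hpos := mul_mul_add_le hx₁ hx₂ (by linarith)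
  have : x₁^2 + x₁*x₂ + x₂^2 ≤ 0 := by linarith
  have h1 : x₁ = 0 := pow_eq_zero_iff (two_ne_zero) |>.1 (le_antisymm (by linarith [sq_nonneg (x₁ + 2*x₂)]) (sq_nonneg x₁))
  have h2 : x₂ = 0 := pow_eq_zero_iff (two_ne_zero) |>.1 (le_antisymm (by linarith [sq_nonneg (x₂ + 2*x₁)]) (sq_nonneg x₂))
  simp [h1, h2]

/-! ### Upper bounds for Q on an edge -/

/-- The weighted Cauchy-Schwarz inequality for three plane vectors of length `√S`. -/
theorem weighted_cauchy_schwarz_three {l₁ l₂ l₃ S a₁ b₁ a₂ b₂ a₃ b₃ p₁ p₂ q₁ q₂ r₁ r₂ : ℝ}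
    (h₁ : 0 ≤ l₁) (h₂ : 0 ≤ l₂) (h₃ : 0 ≤ l₃) (hl : l₁ + l₂ + l₃ = 1)
    (hp : p₁^2 + p₂^2 = S) (hq : q₁^2 + q₂^2 = S) (hr : r₁^2 + r₂^2 = S) :
    (l₁*(a₁*p₁ + b₁*p₂) + l₂*(a₂*q₁ + b₂*q₂) + l₃*(a₃*r₁ + b₃*r₂))^2 ≤
      S * (l₁*(a₁^2 + b₁^2) + l₂*(a₂^2 + b₂^2) + l₃*(a₃^2 + b₃^2)) := by
  set Q := l₁*(a₁*p₁ + b₁*p₂) + l₂*(a₂*q₁ + b₂*q₂) + l₃*(a₃*r₁ + b₃*r₂) with hQ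
  set Z := l₁*(a₁^2 + b₁^2) + l₂*(a₂^2 + b₂^2) + l₃*(a₃^2 + b₃^2) with hZ
  have key : ∀ t : ℝ, 0 ≤ S * (t * t) + (-2*Q) * t + Z := by
    intro t
    have e : S * (t * t) + (-2*Q) * t + Z = l₁*((t*p₁ - a₁)^2 + (t*p₂ - b₁)^2)
        + l₂*((t*q₁ - a₂)^2 + (t*q₂ - b₂)^2) + l₃*((t*r₁ - a₃)^2 + (t*r₂ - b₃)^2) := by
      rw [hQ, hZ]
      have : S * (t*t) = (l₁*(p₁^2+p₂^2) + l₂*(q₁^2+q₂^2) + l₃*(r₁^2+r₂^2)) * (t*t) := by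
        rw [hp, hq, hr]; rw [← add_mul, ← add_mul, hl, one_mul]
      rw [this]; ring
    rw [e]; positivity
  have := discrim_le_zero key
  unfold discrim at this
  nlinarith

theorem sum_cubes_ge {l₁ l₂ l₃ : ℝ} (h₁ : 0 ≤ l₁) (h₂ : 0 ≤ l₂) (h₃ : 0 ≤ l₃)
    (hl : l₁ + l₂ + l₃ = 1) : 1/9 ≤ l₁^3 + l₂^3 + l₃^3 := by
  have k : ∀ l : ℝ, 0 ≤ l → l/3 - 2/27 ≤ l^3 := by
    intro l h0
    nlinarith [mul_nonneg (by linarith : 0 ≤ l + 2/3) (sq_nonneg (l - 1/3))]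
  linarith [k _ h₁, k _ h₂, k _ h₃]

/-- Three intervals of the edge `[-1/2, 1/2]`, each paired with a vector of length `√S`. -/
theorem three_cell_bound {d e h v S p₁ p₂ q₁ q₂ r₁ r₂ : ℝ}
    (hd : -(1/2) ≤ d) (hde : d ≤ e) (he : e ≤ 1/2)
    (hp : p₁^2 + p₂^2 = S) (hq : q₁^2 + q₂^2 = S) (hr : r₁^2 + r₂^2 = S) :
    (((d^2 - 1/4)/2 - v*(d+1/2))*p₁ - h*(d+1/2)*p₂ + (((e^2 - d^2)/2 - v*(e-d))*q₁ - h*(e-d)*q₂)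
      + (((1/4 - e^2)/2 - v*(1/2-e))*r₁ - h*(1/2-e)*r₂))^2 ≤ S * (h^2 + v^2 + 2/27) := by
  have hS : 0 ≤ S := by rw [← hp]; positivity
  have h1 : 0 ≤ d + 1/2 := by linarith
  have h2 : 0 ≤ e - d := by linarith
  have h3 : 0 ≤ 1/2 - e := by linarith
  have := weighted_cauchy_schwarz_three (a₁ := (d-1/2)/2 - v) (b₁ := -h) (a₂ := (d+e)/2 - v)
    (b₂ := -h) (a₃ := (e+1/2)/2 - v) (b₃ := -h) h1 h2 h3 (by ring) hp hq hr
  have hc := sum_cubes_ge h1 h2 h3 (by ring)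
  calc _ = _ := by ring
    _ ≤ _ := this
    _ ≤ _ := by
      apply mul_le_mul_of_nonneg_left _ hS
      -- The weighted squared midpoints add up to 1/12 - (∑ lᵢ³)/12, at most 1/12 - 1/108 = 2/27.
      nlinarith

/-- Two intervals of the edge `[-1/2, 1/2]`, each paired with a vector of length `√S`. -/
theorem two_cell_bound {d h v S p₁ p₂ q₁ q₂ : ℝ} (hd : -(1/2) ≤ d) (hd' : d ≤ 1/2)
    (hp : p₁^2 + p₂^2 = S) (hq : q₁^2 + q₂^2 = S) :
    (((d^2 - 1/4)/2 - v*(d+1/2))*p₁ - h*(d+1/2)*p₂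
      + (((1/4 - d^2)/2 - v*(1/2-d))*q₁ - h*(1/2-d)*q₂))^2 ≤ S * (h^2 + v^2 + 1/16 - d^2/4) := by
  have h1 : 0 ≤ d + 1/2 := by linarith
  have h3 : 0 ≤ 1/2 - d := by linarith
  have := weighted_cauchy_schwarz_three (a₁ := (d-1/2)/2 - v) (b₁ := -h) (a₂ := 0)
    (b₂ := 0) (a₃ := (d+1/2)/2 - v) (b₃ := -h) h1 le_rfl h3 (by ring) hp hp hq
  calc _ = _ := by ring
    _ ≤ _ := this
    _ = _ := by ring

/-- The two-cell bound that takes the angle between the two vectors into account; `k` is the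
cotangent of half of that angle. -/
theorem two_cell_angle_bound {d h v S p₁ p₂ q₁ q₂ k : ℝ}
    (hp : p₁^2 + p₂^2 = S) (hq : q₁^2 + q₂^2 = S)
    (hc : (p₁*q₁ + p₂*q₂)*(1+k^2) = S*(k^2-1)) (hs : (p₁*q₂ - p₂*q₁)*(1+k^2) = 2*k*S) :
    (((d^2 - 1/4)/2 - v*(d+1/2))*p₁ - h*(d+1/2)*p₂
      + (((1/4 - d^2)/2 - v*(1/2-d))*q₁ - h*(1/2-d)*q₂))^2 * (1+k^2) ≤
      S * (k^2*(h^2+v^2) + 2*k*h*(1/4-d^2) + ((1/4+2*d*v-d^2)^2 + 4*h^2*d^2)) := by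
  set m₁ := (d^2 - 1/4)/2 - v*(d+1/2) with hm₁
  set m₂ := -(h*(d+1/2)) with hm₂
  set n₁ := (1/4 - d^2)/2 - v*(1/2-d) with hn₁
  set n₂ := -(h*(1/2-d)) with hn₂
  -- Here m and n are the integrals of z - V over the two cells. Rotating q onto p adds m and the
  -- rotated n into one vector, and the right side is S times its squared length.
  have hkey : (m₁*p₁ + m₂*p₂ + (n₁*q₁ + n₂*q₂))^2 ≤ S*(m₁^2+m₂^2+n₁^2+n₂^2)
      + 2*((p₁*q₁+p₂*q₂)*(m₁*n₁+m₂*n₂) + (p₁*q₂-p₂*q₁)*(m₁*n₂-m₂*n₁)) := by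
    have e : S*(m₁^2+m₂^2+n₁^2+n₂^2) = (p₁^2+p₂^2)*(m₁^2+m₂^2) + (q₁^2+q₂^2)*(n₁^2+n₂^2) := by
      rw [hp, hq]; ring
    rw [e]
    nlinarith [sq_nonneg (m₁*p₂ - m₂*p₁ + (n₁*q₂ - n₂*q₁))]
  have hk : 0 ≤ 1 + k^2 := by positivity
  have h1 := mul_le_mul_of_nonneg_right hkey hk
  have e2 : (S*(m₁^2+m₂^2+n₁^2+n₂^2)
      + 2*((p₁*q₁+p₂*q₂)*(m₁*n₁+m₂*n₂) + (p₁*q₂-p₂*q₁)*(m₁*n₂-m₂*n₁)))*(1+k^2)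
      = S*((m₁^2+m₂^2+n₁^2+n₂^2)*(1+k^2) + 2*((k^2-1)*(m₁*n₁+m₂*n₂) + 2*k*(m₁*n₂-m₂*n₁))) := by
    linear_combination 2*(m₁*n₁+m₂*n₂)*hc + 2*(m₁*n₂-m₂*n₁)*hs
  rw [e2] at h1
  calc _ = (m₁*p₁ + m₂*p₂ + (n₁*q₁ + n₂*q₂))^2 * (1+k^2) := by rw [hm₂, hn₂]; ring
    _ ≤ _ := h1
    _ = _ := by rw [hm₁, hm₂, hn₁, hn₂]; ring

/-- The function (3S - m)²/S increases for S ≥ |m|/3. Thus a bound Q² ≤ S G may be evaluated at the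
known lower bound S₀ for S, which removes S from the problem. -/
theorem sq_div_mono {S S₀ m : ℝ} (hS₀ : 0 < S₀) (hS : S₀ ≤ S) (hm : m ≤ 3*S₀) (hm' : -m ≤ 3*S₀) :
    (3*S₀ - m)^2 * S ≤ (3*S - m)^2 * S₀ := by
  have h1 : m^2 ≤ 9*S₀*S := by nlinarith
  nlinarith [mul_nonneg (sub_nonneg.2 hS) (sub_nonneg.2 h1)]

theorem reduce_radius {S S₀ m G K Q : ℝ} (hS₀ : 0 < S₀) (hS : S₀ ≤ S) (hm : m ≤ 3*S₀)
    (hm' : -m ≤ 3*S₀) (hQ : Q = (3*S - m)/2) (hK : 0 ≤ K) (h : Q^2 * K ≤ S * G) :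
    (3*S₀ - m)^2 * K ≤ 4 * S₀ * G := by
  have h1 := mul_le_mul_of_nonneg_right (sq_div_mono hS₀ hS hm hm') hK
  have h2 : 0 < S := by linarith
  have h3 : (3*S₀ - m)^2 * K * S ≤ 4*S₀*G*S := by
    rw [hQ] at h
    have := mul_le_mul_of_nonneg_left h hS₀.le
    nlinarith
  exact le_of_mul_le_mul_right h3 h2

theorem offset_bounds {x w : ℝ} (h : x^2 ≤ w) :
    w/12 + x/6 ≤ 3*(25/432 + w/12) ∧ -(w/12 + x/6) ≤ 3*(25/432 + w/12) := by
  constructor <;> nlinarith [sq_nonneg (x - 1), sq_nonneg (x + 1)]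

section
variable {x y δ S Q p₁ p₂ q₁ q₂ r₁ r₂ : ℝ}

theorem edge_two_cell {d : ℝ} (hd : -(1/2) ≤ d) (hd' : d ≤ 1/2)
    (hδ : d = δ * √3 / 3) (hp : p₁^2 + p₂^2 = S) (hq : q₁^2 + q₂^2 = S)
    (hS : 25/432 + (x^2+y^2)/12 ≤ S) (hQ : Q = (3*S - ((x^2+y^2)/12 + x/6))/2)
    (hQ' : Q = ((d^2 - 1/4)/2 - (y*√3/6)*(d+1/2))*p₁ - ((1-x)*√3/6)*(d+1/2)*p₂
      + (((1/4 - d^2)/2 - (y*√3/6)*(1/2-d))*q₁ - ((1-x)*√3/6)*(1/2-d)*q₂)) :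
    (1200 + 1728*(x^2+y^2)) * δ^2 ≤ 3*(75 + 208*(x^2+y^2) - 576*x^2 + 400*x) := by
  have h := two_cell_bound (h := (1-x)*√3/6) (v := y*√3/6) hd hd' hp hq
  rw [← hQ'] at h
  have hs : √3^2 = 3 := Real.sq_sqrt (by norm_num)
  obtain ⟨b1, b2⟩ := offset_bounds (x := x) (w := x^2+y^2) (by nlinarith [sq_nonneg y])
  have := reduce_radius (by positivity) hS b1 b2 hQ zero_le_one (by rw [mul_one]; exact h)
  have e : ((1-x)*√3/6)^2 + (y*√3/6)^2 + 1/16 - d^2/4 = (1-x)^2/12 + y^2/12 + 1/16 - δ^2/12 := by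
    rw [hδ]; linear_combination ((1-x)^2/36 + y^2/36 - δ^2/36)*hs
  rw [e] at this
  nlinarith

theorem edge_three_cell {d e : ℝ} (hd : -(1/2) ≤ d) (hde : d ≤ e) (he : e ≤ 1/2)
    (hp : p₁^2 + p₂^2 = S) (hq : q₁^2 + q₂^2 = S) (hr : r₁^2 + r₂^2 = S)
    (hS : 25/432 + (x^2+y^2)/12 ≤ S) (hQ : Q = (3*S - ((x^2+y^2)/12 + x/6))/2)
    (hQ' : Q = ((d^2 - 1/4)/2 - (y*√3/6)*(d+1/2))*p₁ - ((1-x)*√3/6)*(d+1/2)*p₂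
      + (((e^2 - d^2)/2 - (y*√3/6)*(e-d))*q₁ - ((1-x)*√3/6)*(e-d)*q₂)
      + (((1/4 - e^2)/2 - (y*√3/6)*(1/2-e))*r₁ - ((1-x)*√3/6)*(1/2-e)*r₂)) :
    576*x^2 - 400*x ≤ 1175/9 + 288*(x^2+y^2) := by
  have h := three_cell_bound (h := (1-x)*√3/6) (v := y*√3/6) hd hde he hp hq hr
  rw [← hQ'] at h
  have hs : √3^2 = 3 := Real.sq_sqrt (by norm_num)
  obtain ⟨b1, b2⟩ := offset_bounds (x := x) (w := x^2+y^2) (by nlinarith [sq_nonneg y])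
  have := reduce_radius (by positivity) hS b1 b2 hQ zero_le_one (by rw [mul_one]; exact h)
  have e : ((1-x)*√3/6)^2 + (y*√3/6)^2 + 2/27 = (1-x)^2/12 + y^2/12 + 2/27 := by
    linear_combination ((1-x)^2/36 + y^2/36)*hs
  rw [e] at this
  nlinarith

/-- `two_cell_angle_bound` with S replaced by 25/432 + w/12 and all lengths rescaled to remove √3.
-/
theorem edge_quadratic_nonpos {d k κ : ℝ} (hδ : d = δ * √3 / 3) (hκ : κ = √3 * k)
    (hp : p₁^2 + p₂^2 = S) (hq : q₁^2 + q₂^2 = S)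
    (hc : (p₁*q₁ + p₂*q₂)*(1+k^2) = S*(k^2-1)) (hs : (p₁*q₂ - p₂*q₁)*(1+k^2) = 2*k*S)
    (hS : 25/432 + (x^2+y^2)/12 ≤ S) (hQ : Q = (3*S - ((x^2+y^2)/12 + x/6))/2)
    (hQ' : Q = ((d^2 - 1/4)/2 - (y*√3/6)*(d+1/2))*p₁ - ((1-x)*√3/6)*(d+1/2)*p₂
      + (((1/4 - d^2)/2 - (y*√3/6)*(1/2-d))*q₁ - ((1-x)*√3/6)*(1/2-d)*q₂)) :
    (225 + 224*(x^2+y^2) + 576*x^2 - 400*x) * (κ^2 + 3)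
      - (1200+1728*(x^2+y^2))*(1-x)*(1-4/3*δ^2)*κ
      + (1200+1728*(x^2+y^2))*((x^2+y^2)-2*x+1-3/4*(1-4/3*(δ*(δ-y)))^2-4/3*(1-x)^2*δ^2) ≤ 0 := by
  have h := two_cell_angle_bound (d := d) (h := (1-x)*√3/6) (v := y*√3/6) hp hq hc hs
  rw [← hQ'] at h
  have hs3 : √3^2 = 3 := Real.sq_sqrt (by norm_num)
  obtain ⟨b1, b2⟩ := offset_bounds (x := x) (w := x^2+y^2) (by nlinarith [sq_nonneg y])
  have := reduce_radius (by positivity) hS b1 b2 hQ (by positivity) h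
  have e : 3*(k^2*(((1-x)*√3/6)^2 + (y*√3/6)^2) + 2*k*((1-x)*√3/6)*(1/4-d^2)
      + ((1/4+2*d*(y*√3/6)-d^2)^2 + 4*((1-x)*√3/6)^2*d^2))
      = κ^2*((1-x)^2/12+y^2/12) + κ*(1-x)*(1/4 - δ^2/3)
        + 3*((1/4 - δ*(δ-y)/3)^2 + (1-x)^2*δ^2/9) := by
    have e1 : d^2 = δ^2/3 := by rw [hδ]; linear_combination δ^2/9*hs3
    have e2 : 2*d*(y*√3/6) = δ*y/3 := by rw [hδ]; linear_combination δ*y/9*hs3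
    have e3 : ((1-x)*√3/6)^2 = (1-x)^2/12 := by linear_combination (1-x)^2/36*hs3
    have e4 : (y*√3/6)^2 = y^2/12 := by linear_combination y^2/36*hs3
    have e5 : κ^2 = 3*k^2 := by rw [hκ]; linear_combination k^2*hs3
    rw [e1, e2, e3, e4, e5, hκ]; ring
  have e5 : κ^2 = 3*k^2 := by rw [hκ]; linear_combination k^2*hs3
  have h3 : (3*(25/432 + (x^2+y^2)/12) - ((x^2+y^2)/12 + x/6))^2 * (3+κ^2) ≤
    4*(25/432 + (x^2+y^2)/12)*(κ^2*((1-x)^2/12+y^2/12) + κ*(1-x)*(1/4 - δ^2/3)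
        + 3*((1/4 - δ*(δ-y)/3)^2 + (1-x)^2*δ^2/9)) := by
    rw [← e, e5]; linarith
  -- 20736 = 144² clears the denominators.
  have h4 := mul_le_mul_of_nonneg_left h3 (by norm_num : (0:ℝ) ≤ 20736)
  linarith
end

/-! ### Integration over a triangle in cone coordinates -/

namespace Quantization

/-- Integrals over the simplex `0 ≤ y ≤ τ ≤ 1`. -/
theorem setIntegral_simplex {g : ℝ × ℝ → ℝ} (hg : Continuous g) :
    ∫ z in {z : ℝ × ℝ | 0 ≤ z.2 ∧ z.2 ≤ z.1 ∧ z.1 ≤ 1}, g z =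
      ∫ τ in (0:ℝ)..1, τ * ∫ s in (0:ℝ)..1, g (τ, τ * s) := by
  set S := {z : ℝ × ℝ | 0 ≤ z.2 ∧ z.2 ≤ z.1 ∧ z.1 ≤ 1} with hS
  have hclosed : IsClosed S :=
    (isClosed_le continuous_const continuous_snd).inter
      ((isClosed_le continuous_snd continuous_fst).inter (isClosed_le continuous_fst continuous_const))
  have hcomp : IsCompact S := by
    refine (isCompact_Icc (a := ((0:ℝ), (0:ℝ))) (b := (1, 1))).of_isClosed_subset hclosed ?_
    rintro ⟨a, b⟩ ⟨h1, h2, h3⟩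
    simp only at h1 h2 h3
    exact ⟨⟨by linarith, h1⟩, ⟨h3, by linarith⟩⟩
  have hint : Integrable (S.indicator g) (volume.prod volume) :=
    (integrable_indicator_iff hclosed.measurableSet).2 (hg.continuousOn.integrableOn_compact hcomp)
  rw [← integral_indicator hclosed.measurableSet, Measure.volume_eq_prod, integral_prod _ hint,
    intervalIntegral.integral_of_le zero_le_one, ← integral_Icc_eq_integral_Ioc,
    ← integral_indicator measurableSet_Icc]
  congr 1
  ext τ
  by_cases hτ : τ ∈ Set.Icc (0:ℝ) 1
  · rw [Set.indicator_of_mem hτ]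
    have h1 : (fun y => S.indicator g (τ, y)) = (Set.Icc 0 τ).indicator (fun y => g (τ, y)) := by
      ext y
      by_cases hy : y ∈ Set.Icc 0 τ
      · rw [Set.indicator_of_mem hy, Set.indicator_of_mem]
        exact ⟨hy.1, hy.2, hτ.2⟩
      · rw [Set.indicator_of_notMem hy, Set.indicator_of_notMem]
        rintro ⟨a, b, _⟩
        exact hy ⟨a, b⟩
    rw [h1, integral_indicator measurableSet_Icc, integral_Icc_eq_integral_Ioc,
      ← intervalIntegral.integral_of_le hτ.1]
    have := intervalIntegral.mul_integral_comp_mul_left (a := 0) (b := 1)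
      (f := fun y => g (τ, y)) (c := τ)
    simp only [mul_zero, mul_one] at this
    exact this.symm
  · rw [Set.indicator_of_notMem hτ]
    have h1 : (fun y => S.indicator g (τ, y)) = fun _ => 0 := by
      ext y
      rw [Set.indicator_of_notMem]
      rintro ⟨a, b, c⟩
      exact hτ ⟨le_trans a b, c⟩
    rw [h1, integral_zero]

/-- The parametrisation of the cone with apex `p` over the line through `q` and `r`. -/
def conePoint (p q r : Plane) (τ s : ℝ) : Plane := p + τ • ((1 - s) • q + s • r - p)

theorem continuous_conePoint (p q r : Plane) :
    Continuous fun z : ℝ × ℝ => conePoint p q r z.1 z.2 := by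
  unfold conePoint; fun_prop

/-- The mean of `φ` over the triangle with vertices `p`, `q`, `r`, in cone coordinates. -/
noncomputable def coneMean (p q r : Plane) (φ : Plane → ℝ) : ℝ :=
  ∫ τ in (0:ℝ)..1, 2 * τ * ∫ s in (0:ℝ)..1, φ (conePoint p q r τ s)

theorem mem_convexHull_triple_iff {p q r z : Plane} :
    z ∈ convexHull ℝ {p, q, r} ↔
      ∃ τ y : ℝ, 0 ≤ y ∧ y ≤ τ ∧ τ ≤ 1 ∧ z = p + (τ • (q - p) + y • (r - q)) := by
  constructor
  · intro hz
    rw [convexHull_insert ⟨q, by simp⟩, convexHull_pair] at hz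
    rw [mem_convexJoin] at hz
    obtain ⟨a, ha, b, ⟨u, v, hu, hv, huv, rfl⟩, ⟨u', v', hu', hv', huv', rfl⟩⟩ := hz
    rw [Set.mem_singleton_iff] at ha
    subst ha
    refine ⟨v', v' * v, by positivity, by nlinarith, by linarith, ?_⟩
    obtain rfl : u = 1 - v := by linarith
    obtain rfl : u' = 1 - v' := by linarith
    module
  · rintro ⟨τ, y, h1, h2, h3, rfl⟩
    have hc := convex_convexHull ℝ ({p, q, r} : Set Plane)
    have hp : p ∈ convexHull ℝ ({p, q, r} : Set Plane) := subset_convexHull _ _ (by simp)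
    have hq : q ∈ convexHull ℝ ({p, q, r} : Set Plane) := subset_convexHull _ _ (by simp)
    have hr : r ∈ convexHull ℝ ({p, q, r} : Set Plane) := subset_convexHull _ _ (by simp)
    have := hc.sum_mem (t := Finset.univ) (w := ![1 - τ, τ - y, y]) (z := ![p, q, r])
      (by intro i _; fin_cases i <;> simp <;> linarith) (by simp [Fin.sum_univ_three])
      (by intro i _; fin_cases i <;> simp [hp, hq, hr])
    simp only [Fin.sum_univ_three] at this
    convert this using 1
    simp only [Matrix.cons_val_zero, Matrix.cons_val_one, Matrix.cons_val]
    module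

/-- An affine bijection carries the simplex onto the triangle, and by uniqueness of Haar measure it
scales Lebesgue measure by a constant. The constant cancels in the normalisation, so the determinant
only has to be nonzero. -/
theorem integral_cond_triangle {p q r : Plane}
    (hdet : (q 0 - p 0) * (r 1 - p 1) - (q 1 - p 1) * (r 0 - p 0) ≠ 0)
    {φ : Plane → ℝ} (hφ : Continuous φ) :
    ∫ x, φ x ∂(ProbabilityTheory.cond volume (convexHull ℝ {p, q, r})) = coneMean p q r φ := by
  set T := convexHull ℝ ({p, q, r} : Set Plane) with hT
  let f : ℝ × ℝ →ₗ[ℝ] Plane :=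
    (LinearMap.fst ℝ ℝ ℝ).smulRight (q - p) + (LinearMap.snd ℝ ℝ ℝ).smulRight (r - q)
  have hf : ∀ z, f z = z.1 • (q - p) + z.2 • (r - q) := fun z => rfl
  have hinj : Function.Injective f := by
    rw [← LinearMap.ker_eq_bot, LinearMap.ker_eq_bot']
    rintro ⟨x, y⟩ h
    rw [hf] at h
    have h0 := congrArg (fun v : Plane => v 0) h
    have h1 := congrArg (fun v : Plane => v 1) h
    simp at h0 h1
    have hx : x * ((q 0 - p 0) * (r 1 - p 1) - (q 1 - p 1) * (r 0 - p 0)) = 0 := by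
      linear_combination (r 1 - q 1) * h0 - (r 0 - q 0) * h1
    have hy : y * ((q 0 - p 0) * (r 1 - p 1) - (q 1 - p 1) * (r 0 - p 0)) = 0 := by
      linear_combination (q 0 - p 0) * h1 - (q 1 - p 1) * h0
    have hx' := (mul_eq_zero.1 hx).resolve_right hdet
    have hy' := (mul_eq_zero.1 hy).resolve_right hdet
    simp [hx', hy']
  let L : (ℝ × ℝ) ≃L[ℝ] Plane :=
    (LinearEquiv.ofInjectiveOfFinrankEq f hinj (by simp)).toContinuousLinearEquiv
  have hL : ∀ z, L z = z.1 • (q - p) + z.2 • (r - q) := fun z => rfl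
  let Φ : (ℝ × ℝ) ≃ₜ Plane := L.toHomeomorph.trans (Homeomorph.addLeft p)
  have hΦ : ∀ z, Φ z = p + (z.1 • (q - p) + z.2 • (r - q)) := fun z => rfl
  have hpre : Φ ⁻¹' T = {z : ℝ × ℝ | 0 ≤ z.2 ∧ z.2 ≤ z.1 ∧ z.1 ≤ 1} := by
    ext z
    rw [Set.mem_preimage, hT, mem_convexHull_triple_iff]
    constructor
    · rintro ⟨τ, y, h1, h2, h3, h⟩
      have : z = (τ, y) := by
        apply hinj
        rw [hΦ] at h
        rw [hf, hf]
        exact add_left_cancel h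
      subst this
      exact ⟨h1, h2, h3⟩
    · rintro ⟨h1, h2, h3⟩
      exact ⟨z.1, z.2, h1, h2, h3, rfl⟩
  have hΦm : Measurable Φ := Φ.continuous.measurable
  obtain ⟨c, hc⟩ : ∃ c : NNReal,
      (volume : Measure Plane) = c • (volume : Measure (ℝ × ℝ)).map Φ := by
    have h1 : (volume : Measure (ℝ × ℝ)).map Φ = (volume : Measure (ℝ × ℝ)).map L := by
      have : (Φ : ℝ × ℝ → Plane) = (fun x => p + x) ∘ L := rfl
      rw [this, ← Measure.map_map (measurable_const_add p) L.continuous.measurable,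
        map_add_left_eq_self]
    exact ⟨_, by rw [h1]; exact Measure.isAddLeftInvariant_eq_smul _ _⟩
  have hTm : MeasurableSet T := by
    rw [hT]
    exact (Set.Finite.isCompact_convexHull ℝ (by simp)).isClosed.measurableSet
  have hc0 : (c : ℝ) ≠ 0 := by
    intro h
    have : c = 0 := by exact_mod_cast h
    rw [this, zero_smul] at hc
    exact (NeZero.ne (volume : Measure Plane)) hc
  have hint : ∀ ψ : Plane → ℝ, Continuous ψ → ∫ x in T, ψ x =
      c * ∫ τ in (0:ℝ)..1, τ * ∫ s in (0:ℝ)..1, ψ (conePoint p q r τ s) := by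
    intro ψ hψ
    have h1 : ∫ z in Φ ⁻¹' T, ψ (Φ z) = ∫ x in T, ψ x ∂((volume : Measure (ℝ × ℝ)).map Φ) :=
      (setIntegral_map hTm hψ.aestronglyMeasurable hΦm.aemeasurable).symm
    have h2 : ∫ x in T, ψ x = c * ∫ x in T, ψ x ∂((volume : Measure (ℝ × ℝ)).map Φ) := by
      conv_lhs => rw [hc]
      rw [Measure.restrict_smul, integral_smul_nnreal_measure]
      rfl
    rw [h2, ← h1, hpre, setIntegral_simplex (g := fun z => ψ (Φ z)) (hψ.comp Φ.continuous)]
    congr 3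
    ext τ
    congr 2
    ext s
    rw [hΦ, conePoint]
    congr 1
    module
  have hvol : (volume T).toReal = c * (1/2) := by
    have := hint (fun _ => 1) continuous_const
    simpa [Measure.real] using this
  rw [ProbabilityTheory.cond, integral_smul_measure, hint φ hφ, ENNReal.toReal_inv, hvol, coneMean,
    smul_eq_mul]
  simp_rw [mul_assoc]
  rw [intervalIntegral.integral_const_mul]
  field_simp

end Quantization

/-! ### Triples of points and existence of a minimiser -/

namespace Quantization

/-- The squared distance between two points of the plane, in coordinates. -/
noncomputable def distSq (a x : Plane) : ℝ := (x 0 - a 0) ^ 2 + (x 1 - a 1) ^ 2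

theorem norm_sub_sq_eq_distSq (a x : Plane) : ‖x - a‖ ^ 2 = distSq a x := by
  rw [EuclideanSpace.norm_sq_eq, Fin.sum_univ_two]
  simp [distSq]

theorem distSq_nonneg (a x : Plane) : 0 ≤ distSq a x := by unfold distSq; positivity

/-- The squared distance to the nearest of three points. -/
noncomputable def minDistSq (a b c x : Plane) : ℝ :=
  min (distSq a x) (min (distSq b x) (distSq c x))

theorem continuous_minDistSq_uncurry :
    Continuous fun z : (Plane × Plane × Plane) × Plane =>
      minDistSq z.1.1 z.1.2.1 z.1.2.2 z.2 := by
  unfold minDistSq distSq; fun_prop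

theorem continuous_minDistSq (a b c : Plane) : Continuous (minDistSq a b c) := by
  unfold minDistSq distSq; fun_prop

theorem continuous_distSq (a : Plane) : Continuous (distSq a) := by
  unfold distSq; fun_prop

theorem minDistSq_nonneg (a b c x : Plane) : 0 ≤ minDistSq a b c x :=
  le_min (distSq_nonneg _ _) (le_min (distSq_nonneg _ _) (distSq_nonneg _ _))

theorem minDistSq_le_left (a b c x : Plane) : minDistSq a b c x ≤ distSq a x := min_le_left _ _

theorem minDistSq_le_mid (a b c x : Plane) : minDistSq a b c x ≤ distSq b x :=
  (min_le_right _ _).trans (min_le_left _ _)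

theorem minDistSq_le_right (a b c x : Plane) : minDistSq a b c x ≤ distSq c x :=
  (min_le_right _ _).trans (min_le_right _ _)

theorem minDistSq_rotate (a b c x : Plane) : minDistSq b c a x = minDistSq a b c x := by
  unfold minDistSq
  rw [← min_assoc, min_comm]

theorem integral_uniformTriangle_eq_coneMean_OAB {φ : Plane → ℝ} (hφ : Continuous φ) :
    ∫ x, φ x ∂uniformTriangle = coneMean vertexO vertexA vertexB φ :=
  integral_cond_triangle (by simp [vertexO, vertexA, vertexB]) hφ

theorem integral_uniformTriangle_eq_coneMean_ABO {φ : Plane → ℝ} (hφ : Continuous φ) :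
    ∫ x, φ x ∂uniformTriangle = coneMean vertexA vertexB vertexO φ := by
  have h : ({vertexO, vertexA, vertexB} : Set Plane) = {vertexA, vertexB, vertexO} := by
    ext; simp; tauto
  rw [uniformTriangle, triangle, h]
  exact integral_cond_triangle (by simp [vertexO, vertexA, vertexB]) hφ

theorem integral_uniformTriangle_eq_coneMean_BOA {φ : Plane → ℝ} (hφ : Continuous φ) :
    ∫ x, φ x ∂uniformTriangle = coneMean vertexB vertexO vertexA φ := by
  have h : ({vertexO, vertexA, vertexB} : Set Plane) = {vertexB, vertexO, vertexA} := by
    ext; simp; tauto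
  rw [uniformTriangle, triangle, h]
  refine integral_cond_triangle ?_ hφ
  have h3 : (0 : ℝ) < √3 := by positivity
  simp only [vertexO, vertexA, vertexB, PiLp.toLp_apply, Matrix.cons_val_zero, Matrix.cons_val_one,
    Matrix.cons_val_fin_one]
  nlinarith

theorem uniformTriangle_univ : uniformTriangle Set.univ = 1 := by
  have h := integral_uniformTriangle_eq_coneMean_OAB (φ := fun _ => 1) continuous_const
  have h2 : coneMean vertexO vertexA vertexB (fun _ => 1) = 1 := by
    simp only [coneMean, intervalIntegral.integral_const, sub_zero, smul_eq_mul, mul_one]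
    rw [intervalIntegral.integral_const_mul, integral_id]
    norm_num
  rw [h2, integral_const, smul_eq_mul, mul_one] at h
  rw [← ENNReal.toReal_eq_one_iff]
  exact h

instance : IsProbabilityMeasure uniformTriangle := ⟨uniformTriangle_univ⟩

theorem isCompact_triangle : IsCompact triangle := Set.Finite.isCompact_convexHull ℝ (by simp)

theorem ae_mem_triangle : ∀ᵐ x ∂uniformTriangle, x ∈ triangle :=
  ProbabilityTheory.ae_cond_mem isCompact_triangle.isClosed.measurableSet

theorem integrable_uniformTriangle {φ : Plane → ℝ} (hφ : Continuous φ) :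
    Integrable φ uniformTriangle := by
  have h : uniformTriangle.restrict triangle = uniformTriangle :=
    Measure.restrict_eq_self_of_ae_mem ae_mem_triangle
  rw [← h]
  exact hφ.continuousOn.integrableOn_compact isCompact_triangle

/-- The mean squared distance to the nearest of three points. -/
noncomputable def meanDistSq (a b c : Plane) : ℝ := ∫ x, minDistSq a b c x ∂uniformTriangle

theorem distortion_triple (a b c : Plane) :
    distortion uniformTriangle {a, b, c} = ENNReal.ofReal (meanDistSq a b c) := by
  rw [distortion, meanDistSq, ofReal_integral_eq_lintegral_ofReal
    (integrable_uniformTriangle (continuous_minDistSq a b c))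
    (Filter.Eventually.of_forall (minDistSq_nonneg a b c))]
  congr 1
  ext x
  have h : ∀ y : Plane, ‖x - y‖ₑ ^ 2 = ENNReal.ofReal (distSq y x) := by
    intro y
    rw [← norm_sub_sq_eq_distSq, ENNReal.ofReal_pow (norm_nonneg _), ofReal_norm]
  rw [iInf_insert, iInf_insert, iInf_singleton, h, h, h, minDistSq]
  have hm : Monotone ENNReal.ofReal := fun _ _ h => ENNReal.ofReal_le_ofReal h
  rw [hm.map_min, hm.map_min]

theorem distortion_empty : distortion uniformTriangle ∅ = ⊤ := by
  simp [distortion]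

/-- Repetitions are allowed, so triples cover all nonempty sets of at most three points. -/
theorem exists_eq_triple {s : Set Plane} (hs : s.Nonempty) (h : s.encard ≤ 3) :
    ∃ a b c, s = {a, b, c} := by
  have hfin : s.Finite := Set.finite_of_encard_le_coe (k := 3) h
  obtain ⟨a, ha⟩ := hs
  have h1 : (s \ {a}).encard ≤ 2 := by
    have := Set.encard_sdiff_singleton_add_one ha
    rw [← this] at h
    exact (ENat.add_le_add_iff_right ENat.one_ne_top).1 (h.trans (by norm_num))
  rcases Set.eq_empty_or_nonempty (s \ {a}) with h0 | ⟨b, hb⟩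
  · refine ⟨a, a, a, ?_⟩
    ext x
    rw [Set.sdiff_eq_empty] at h0
    simp only [Set.mem_insert_iff, Set.mem_singleton_iff, or_self]
    exact ⟨fun hx => h0 hx, fun hx => hx ▸ ha⟩
  have h2 : ((s \ {a}) \ {b}).encard ≤ 1 := by
    have := Set.encard_sdiff_singleton_add_one hb
    rw [← this] at h1
    exact (ENat.add_le_add_iff_right ENat.one_ne_top).1 (h1.trans (by norm_num))
  have hs : s = insert a (insert b ((s \ {a}) \ {b})) := by
    rw [Set.insert_sdiff_self_of_mem hb, Set.insert_sdiff_self_of_mem ha]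
  rw [Set.encard_le_one_iff_eq] at h2
  rcases h2 with h0 | ⟨c, hc⟩
  · exact ⟨a, b, b, by rw [hs, h0]; simp⟩
  · exact ⟨a, b, c, by rw [hs, hc]⟩

theorem continuous_meanDistSq :
    Continuous fun z : Plane × Plane × Plane => meanDistSq z.1 z.2.1 z.2.2 := by
  have h : uniformTriangle.restrict triangle = uniformTriangle :=
    Measure.restrict_eq_self_of_ae_mem ae_mem_triangle
  unfold meanDistSq
  rw [← h]
  exact continuous_parametric_integral_of_continuous continuous_minDistSq_uncurry
    isCompact_triangle

theorem triangle_subset_closedBall : triangle ⊆ Metric.closedBall 0 1 := by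
  refine convexHull_min ?_ (convex_closedBall _ _)
  intro x hx
  rw [mem_closedBall_zero_iff, ← sq_le_one_iff₀ (norm_nonneg _), EuclideanSpace.norm_sq_eq,
    Fin.sum_univ_two]
  have h3 : (√3 : ℝ) ^ 2 = 3 := Real.sq_sqrt (by norm_num)
  rcases hx with rfl | rfl | rfl
  · simp [vertexO]
  · simp [vertexA]
  · simp [vertexB, div_pow, h3]
    norm_num

/-- A minimising triple exists. -/
theorem exists_minimizer : ∃ a b c : Plane, ∀ a' b' c', meanDistSq a b c ≤ meanDistSq a' b' c' := by
  set K : Set (Plane × Plane × Plane) :=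
    Metric.closedBall 0 3 ×ˢ Metric.closedBall 0 3 ×ˢ Metric.closedBall 0 3 with hK
  have hKc : IsCompact K :=
    (isCompact_closedBall _ _).prod ((isCompact_closedBall _ _).prod (isCompact_closedBall _ _))
  obtain ⟨⟨a, b, c⟩, -, hmin⟩ := hKc.exists_isMinOn ⟨(0, 0, 0), by simp [hK]⟩
    continuous_meanDistSq.continuousOn
  refine ⟨a, b, c, fun a' b' c' => ?_⟩
  classical
  -- The triangle lies in the unit ball, so a point of norm above 3 is farther than 2 from it, while
  -- the origin is within 1. Moving such points to 0 never increases a distance, and the minimum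
  -- over a compact set is global.
  let π : Plane → Plane := fun x => if ‖x‖ ≤ 3 then x else 0
  have hπ : ∀ x, π x ∈ Metric.closedBall (0 : Plane) 3 := by
    intro x
    by_cases h : ‖x‖ ≤ 3 <;> simp [π, h]
  have hd : ∀ x y, y ∈ triangle → distSq (π x) y ≤ distSq x y := by
    intro x y hy
    by_cases h : ‖x‖ ≤ 3
    · simp [π, h]
    · have h1 : ‖y‖ ≤ 1 := by simpa using triangle_subset_closedBall hy
      simp only [π, h, if_false]
      rw [← norm_sub_sq_eq_distSq, ← norm_sub_sq_eq_distSq, sub_zero]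
      have h2 : ‖x‖ ≤ ‖y - x‖ + ‖y‖ := by
        have := norm_sub_le y (y - x)
        rw [sub_sub_cancel] at this
        linarith
      exact pow_le_pow_left₀ (norm_nonneg _) (by linarith) 2
  refine (hmin (show (π a', π b', π c') ∈ K from ⟨hπ _, hπ _, hπ _⟩)).trans ?_
  refine integral_mono_ae (integrable_uniformTriangle (continuous_minDistSq _ _ _))
    (integrable_uniformTriangle (continuous_minDistSq _ _ _)) ?_
  filter_upwards [ae_mem_triangle] with x hx
  exact min_le_min (hd _ _ hx) (min_le_min (hd _ _ hx) (hd _ _ hx))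

end Quantization

/-! ### Stationarity under dilation about a vertex, and moments -/

namespace Quantization

theorem continuous_coneInner {p q r : Plane} {φ : Plane → ℝ} (hφ : Continuous φ) :
    Continuous fun σ : ℝ => ∫ s in (0:ℝ)..1, φ (conePoint p q r σ s) :=
  intervalIntegral.continuous_parametric_intervalIntegral_of_continuous'
    (f := fun σ s => φ (conePoint p q r σ s)) (hφ.comp (continuous_conePoint p q r)) 0 1

theorem distSq_homothety (p a x : Plane) {u : ℝ} (hu : u ≠ 0) :
    distSq (p + u⁻¹ • (a - p)) (p + x) = (u ^ 2)⁻¹ * distSq a (p + u • x) := by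
  simp only [distSq, PiLp.add_apply, PiLp.smul_apply, PiLp.sub_apply, smul_eq_mul]
  field_simp
  ring

theorem minDistSq_homothety (p a b c x : Plane) {u : ℝ} (hu : u ≠ 0) :
    minDistSq (p + u⁻¹ • (a - p)) (p + u⁻¹ • (b - p)) (p + u⁻¹ • (c - p)) (p + x) =
      (u ^ 2)⁻¹ * minDistSq a b c (p + u • x) := by
  have h : 0 ≤ (u ^ 2)⁻¹ := by positivity
  rw [minDistSq, distSq_homothety p a x hu, distSq_homothety p b x hu, distSq_homothety p c x hu,
    minDistSq, mul_min_of_nonneg _ _ h, mul_min_of_nonneg _ _ h]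

/-- For an optimal triple, the mean over an edge of the squared distance to the nearest point is
twice the mean over the triangle. -/
theorem edge_mean_eq_two_mul {p q r a b c : Plane}
    (hI : ∀ φ : Plane → ℝ, Continuous φ → ∫ x, φ x ∂uniformTriangle = coneMean p q r φ)
    (hmin : ∀ a' b' c', meanDistSq a b c ≤ meanDistSq a' b' c') :
    ∫ s in (0:ℝ)..1, minDistSq a b c ((1 - s) • q + s • r) = 2 * meanDistSq a b c := by
  set D := meanDistSq a b c with hD
  let g : ℝ → ℝ := fun σ => ∫ s in (0:ℝ)..1, minDistSq a b c (conePoint p q r σ s)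
  have hg : Continuous g := continuous_coneInner (continuous_minDistSq a b c)
  have hk : Continuous fun σ => 2 * σ * g σ := by fun_prop
  let H : ℝ → ℝ := fun u => ∫ σ in (0:ℝ)..u, 2 * σ * g σ
  have hH1 : H 1 = D := by
    rw [hD, meanDistSq, hI _ (continuous_minDistSq a b c)]
    rfl
  have hHd : HasDerivAt H (2 * 1 * g 1) 1 :=
    intervalIntegral.integral_hasDerivAt_right (hk.intervalIntegrable _ _)
      hk.aestronglyMeasurable.stronglyMeasurableAtFilter hk.continuousAt
  -- The triple dilated by u⁻¹ about p has mean squared distance H(u)/u⁴: two powers come from area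
  -- and two from squared distance. At u = 1 equality holds, and differentiating there gives 2 g(1)
  -- = 4D.
  have hle : ∀ u : ℝ, 0 < u → D * u ^ 4 ≤ H u := by
    intro u hu
    have h1 := hmin (p + u⁻¹ • (a - p)) (p + u⁻¹ • (b - p)) (p + u⁻¹ • (c - p))
    rw [meanDistSq, hI _ (continuous_minDistSq _ _ _), coneMean] at h1
    have h2 : ∀ τ s : ℝ, minDistSq (p + u⁻¹ • (a - p)) (p + u⁻¹ • (b - p)) (p + u⁻¹ • (c - p))
        (conePoint p q r τ s) = (u ^ 2)⁻¹ * minDistSq a b c (conePoint p q r (u * τ) s) := by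
      intro τ s
      rw [conePoint, minDistSq_homothety _ _ _ _ _ hu.ne', conePoint, smul_smul]
    simp only [h2, intervalIntegral.integral_const_mul] at h1
    have h3 : ∀ τ : ℝ, 2 * τ * ((u ^ 2)⁻¹ *
        ∫ s in (0:ℝ)..1, minDistSq a b c (conePoint p q r (u * τ) s)) =
        (u ^ 3)⁻¹ * (2 * (u * τ) * g (u * τ)) := by
      intro τ
      simp only [g]
      field_simp
    simp only [h3, intervalIntegral.integral_const_mul] at h1
    have h4 := intervalIntegral.mul_integral_comp_mul_left (a := 0) (b := 1)
      (f := fun σ => 2 * σ * g σ) (c := u)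
    simp only [mul_zero, mul_one] at h4
    have h5 : H u = u * ∫ τ in (0:ℝ)..1, 2 * (u * τ) * g (u * τ) := h4.symm
    rw [h5]
    have h6 : u ^ 4 * ((u ^ 3)⁻¹ * ∫ τ in (0:ℝ)..1, 2 * (u * τ) * g (u * τ)) =
        u * ∫ τ in (0:ℝ)..1, 2 * (u * τ) * g (u * τ) := by
      field_simp
    rw [← h6, mul_comm D]
    exact mul_le_mul_of_nonneg_left h1 (by positivity)
  have hloc : IsLocalMin (fun u => H u - D * u ^ 4) 1 := by
    filter_upwards [lt_mem_nhds (show (0:ℝ) < 1 by norm_num)] with u hu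
    have := hle u hu
    simp only [hH1]
    linarith
  have hder : HasDerivAt (fun u => H u - D * u ^ 4) (2 * 1 * g 1 - D * (4 * 1 ^ 3)) 1 := by
    have := (hasDerivAt_pow 4 (1:ℝ)).const_mul D
    exact hHd.sub (by simpa using this)
  have h0 := hloc.hasDerivAt_eq_zero hder
  have hg1 : g 1 = ∫ s in (0:ℝ)..1, minDistSq a b c ((1 - s) • q + s • r) := by
    simp only [g, conePoint, one_smul, add_sub_cancel]
  rw [← hg1]
  linarith

theorem integral_quadratic (A B C a b : ℝ) :
    ∫ s in a..b, (A * s ^ 2 + B * s + C) =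
      A * (b ^ 3 - a ^ 3) / 3 + B * (b ^ 2 - a ^ 2) / 2 + C * (b - a) := by
  rw [intervalIntegral.integral_add (by apply Continuous.intervalIntegrable; fun_prop)
    (by apply Continuous.intervalIntegrable; fun_prop),
    intervalIntegral.integral_add (by apply Continuous.intervalIntegrable; fun_prop)
    (by apply Continuous.intervalIntegrable; fun_prop)]
  have hB : ∫ s in a..b, B * s = B * ∫ s in a..b, s := intervalIntegral.integral_const_mul _ _
  rw [hB]
  simp only [intervalIntegral.integral_const_mul, integral_pow, integral_id,
    intervalIntegral.integral_const, smul_eq_mul]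
  norm_num
  ring

theorem integral_cubic (Z A B C a b : ℝ) :
    ∫ s in a..b, (Z * s ^ 3 + A * s ^ 2 + B * s + C) =
      Z * (b ^ 4 - a ^ 4) / 4 + A * (b ^ 3 - a ^ 3) / 3 + B * (b ^ 2 - a ^ 2) / 2
        + C * (b - a) := by
  have h : ∀ s, Z * s ^ 3 + A * s ^ 2 + B * s + C = Z * s ^ 3 + (A * s ^ 2 + B * s + C) := by
    intro s; ring
  simp only [h]
  rw [intervalIntegral.integral_add (by apply Continuous.intervalIntegrable; fun_prop)
    (by apply Continuous.intervalIntegrable; fun_prop), integral_quadratic]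
  simp only [intervalIntegral.integral_const_mul, integral_pow]
  norm_num
  ring

/-- The second moment of the uniform distribution about `V`. -/
theorem integral_distSq (V : Plane) :
    ∫ x, distSq V x ∂uniformTriangle =
      1 / 12 + ((V 0 - 1 / 2) ^ 2 + (V 1 - √3 / 6) ^ 2) := by
  have h3 : (√3 : ℝ) ^ 2 = 3 := Real.sq_sqrt (by norm_num)
  rw [integral_uniformTriangle_eq_coneMean_OAB (continuous_distSq V), coneMean]
  have h1 : ∀ τ s : ℝ, distSq V (conePoint vertexO vertexA vertexB τ s) =
      τ ^ 2 * s ^ 2 + (-τ ^ 2 + τ * V 0 - √3 * τ * V 1) * s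
        + (τ ^ 2 - 2 * τ * V 0 + V 0 ^ 2 + V 1 ^ 2) := by
    intro τ s
    simp [distSq, conePoint, vertexO, vertexA, vertexB]
    linear_combination (1/4 * τ ^ 2 * s ^ 2) * h3
  simp only [h1, integral_quadratic]
  have h2 : ∀ τ : ℝ, 2 * τ * (τ ^ 2 * (1 ^ 3 - 0 ^ 3) / 3 +
      (-τ ^ 2 + τ * V 0 - √3 * τ * V 1) * (1 ^ 2 - 0 ^ 2) / 2
        + (τ ^ 2 - 2 * τ * V 0 + V 0 ^ 2 + V 1 ^ 2) * (1 - 0)) =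
      (5 / 3) * τ ^ 3 + (- 3 * V 0 - √3 * V 1) * τ ^ 2 + 2 * (V 0 ^ 2 + V 1 ^ 2) * τ + 0 := by
    intro τ; ring
  simp only [h2, integral_cubic]
  linear_combination (- 1 / 36) * h3

/-- The variance in any direction is `1/24`. -/
theorem integral_affine_sq (α β γ : ℝ) :
    ∫ x : Plane, (α * x 0 + β * x 1 + γ) ^ 2 ∂uniformTriangle =
      (α ^ 2 + β ^ 2) / 24 + (α / 2 + β * (√3 / 6) + γ) ^ 2 := by
  have h3 : (√3 : ℝ) ^ 2 = 3 := Real.sq_sqrt (by norm_num)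
  rw [integral_uniformTriangle_eq_coneMean_OAB (by fun_prop), coneMean]
  have h1 : ∀ τ s : ℝ, (α * (conePoint vertexO vertexA vertexB τ s) 0
      + β * (conePoint vertexO vertexA vertexB τ s) 1 + γ) ^ 2 =
      (τ ^ 2 * (β * √3 / 2 - α / 2) ^ 2) * s ^ 2
        + (2 * τ * (β * √3 / 2 - α / 2) * (α * τ + γ)) * s + (α * τ + γ) ^ 2 := by
    intro τ s
    simp [conePoint, vertexO, vertexA, vertexB]
    ring
  simp only [h1, integral_quadratic]
  have h2 : ∀ τ : ℝ, 2 * τ * ((τ ^ 2 * (β * √3 / 2 - α / 2) ^ 2) * (1 ^ 3 - 0 ^ 3) / 3 +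
      (2 * τ * (β * √3 / 2 - α / 2) * (α * τ + γ)) * (1 ^ 2 - 0 ^ 2) / 2
        + (α * τ + γ) ^ 2 * (1 - 0)) =
      (2 * ((β * √3 / 2 - α / 2) ^ 2 / 3 + (β * √3 / 2 - α / 2) * α + α ^ 2)) * τ ^ 3
        + (2 * ((β * √3 / 2 - α / 2) * γ + 2 * α * γ)) * τ ^ 2 + (2 * γ ^ 2) * τ + 0 := by
    intro τ; ring
  simp only [h2, integral_cubic]
  linear_combination (β ^ 2 / 72) * h3

end Quantization

/-! ### The value 11/432 as an upper bound, stationarity about the circumcentre, collinear triples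
-/

namespace Quantization

theorem integral_le_of_le_quadratic {φ : ℝ → ℝ} (hφ : Continuous φ) {A B C a b : ℝ} (hab : a ≤ b)
    (h : ∀ s, φ s ≤ A * s ^ 2 + B * s + C) :
    ∫ s in a..b, φ s ≤ A * (b ^ 3 - a ^ 3) / 3 + B * (b ^ 2 - a ^ 2) / 2 + C * (b - a) := by
  rw [← integral_quadratic]
  exact intervalIntegral.integral_mono_on hab (hφ.intervalIntegrable _ _)
    (by apply Continuous.intervalIntegrable; fun_prop) fun s _ => h s

theorem integral_le_of_le_cubic {φ : ℝ → ℝ} (hφ : Continuous φ) {Z A B C a b : ℝ} (hab : a ≤ b)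
    (h : ∀ s ∈ Set.Icc a b, φ s ≤ Z * s ^ 3 + A * s ^ 2 + B * s + C) :
    ∫ s in a..b, φ s ≤ Z * (b ^ 4 - a ^ 4) / 4 + A * (b ^ 3 - a ^ 3) / 3
      + B * (b ^ 2 - a ^ 2) / 2 + C * (b - a) := by
  rw [← integral_cubic]
  exact intervalIntegral.integral_mono_on hab (hφ.intervalIntegrable _ _)
    (by apply Continuous.intervalIntegrable; fun_prop) h

theorem integral_split_three {φ : ℝ → ℝ} (hφ : Continuous φ) (a b c d : ℝ) :
    ∫ s in a..d, φ s = (∫ s in a..b, φ s) + (∫ s in b..c, φ s) + ∫ s in c..d, φ s := by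
  rw [intervalIntegral.integral_add_adjacent_intervals (hφ.intervalIntegrable _ _)
    (hφ.intervalIntegrable _ _), intervalIntegral.integral_add_adjacent_intervals
    (hφ.intervalIntegrable _ _) (hφ.intervalIntegrable _ _)]

theorem distSq_meanP (τ s : ℝ) : distSq meanP (conePoint vertexO vertexA vertexB τ s) =
    τ ^ 2 * s ^ 2 + (-τ ^ 2) * s + (τ ^ 2 - 7 / 12 * τ + 49 / 432) := by
  have h3 : (√3 : ℝ) ^ 2 = 3 := Real.sq_sqrt (by norm_num)
  have h0 : (√3 : ℝ) ≠ 0 := by positivity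
  have hi : 7 / (24 * √3) = 7 * √3 / 72 := by field_simp; rw [h3]; norm_num
  simp [distSq, conePoint, vertexO, vertexA, vertexB, meanP, hi]
  linear_combination (1/4 * τ ^ 2 * s ^ 2 - 7 / 72 * τ * s + 49 / 5184) * h3

theorem distSq_meanQ (τ s : ℝ) : distSq meanQ (conePoint vertexO vertexA vertexB τ s) =
    τ ^ 2 * s ^ 2 + (-τ ^ 2 + 5 / 12 * τ) * s + (τ ^ 2 - 17 / 12 * τ + 229 / 432) := by
  have h3 : (√3 : ℝ) ^ 2 = 3 := Real.sq_sqrt (by norm_num)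
  have h0 : (√3 : ℝ) ≠ 0 := by positivity
  have hi : 7 / (24 * √3) = 7 * √3 / 72 := by field_simp; rw [h3]; norm_num
  simp [distSq, conePoint, vertexO, vertexA, vertexB, meanQ, hi]
  linear_combination (1/4 * τ ^ 2 * s ^ 2 - 7 / 72 * τ * s + 49 / 5184) * h3

theorem distSq_meanR (τ s : ℝ) : distSq meanR (conePoint vertexO vertexA vertexB τ s) =
    τ ^ 2 * s ^ 2 + (-τ ^ 2 - 5 / 12 * τ) * s + (τ ^ 2 - τ + 229 / 432) := by
  have h3 : (√3 : ℝ) ^ 2 = 3 := Real.sq_sqrt (by norm_num)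
  have h0 : (√3 : ℝ) ≠ 0 := by positivity
  have hi : 11 / (12 * √3) = 11 * √3 / 36 := by field_simp; rw [h3]; norm_num
  simp [distSq, conePoint, vertexO, vertexA, vertexB, meanR, hi]
  linear_combination (1/4 * τ ^ 2 * s ^ 2 - 11 / 36 * τ * s + 121 / 1296) * h3

/-- Assigning each part of a slice to one chosen mean bounds the minimum from above, so no
verification that this mean is the nearest is needed. -/
theorem meanDistSq_means_le : meanDistSq meanP meanQ meanR ≤ 11 / 432 := by
  have hc := continuous_minDistSq meanP meanQ meanR
  let f : ℝ → ℝ → ℝ := fun τ s => minDistSq meanP meanQ meanR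
    (conePoint vertexO vertexA vertexB τ s)
  have hf : ∀ τ, Continuous (f τ) := fun τ =>
    hc.comp ((continuous_conePoint _ _ _).comp (Continuous.prodMk_right τ))
  let g : ℝ → ℝ := fun τ => ∫ s in (0:ℝ)..1, f τ s
  have hg : Continuous g := continuous_coneInner hc
  have hk : Continuous fun τ => 2 * τ * g τ := by fun_prop
  have hP : ∀ τ s, f τ s ≤ _ := fun τ s =>
    (minDistSq_le_left meanP meanQ meanR _).trans_eq (distSq_meanP τ s)
  have hQ : ∀ τ s, f τ s ≤ _ := fun τ s =>
    (minDistSq_le_mid meanP meanQ meanR _).trans_eq (distSq_meanQ τ s)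
  have hR : ∀ τ s, f τ s ≤ _ := fun τ s =>
    (minDistSq_le_right meanP meanQ meanR _).trans_eq (distSq_meanR τ s)
  have e1 : ∀ τ ∈ Set.Icc (0:ℝ) (1/2), 2 * τ * g τ ≤
      5 / 3 * τ ^ 3 + (-7 / 6) * τ ^ 2 + 49 / 216 * τ + 0 := by
    intro τ hτ
    have := integral_le_of_le_quadratic (hf τ) zero_le_one (hP τ)
    have h2 := mul_le_mul_of_nonneg_left this (show 0 ≤ 2 * τ by linarith [hτ.1])
    refine h2.trans_eq ?_
    ring
  have e2 : ∀ τ ∈ Set.Icc (1/2:ℝ) (2/3), 2 * τ * g τ ≤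
      5 / 3 * τ ^ 3 + (-7 / 6 - 10 / 3) * τ ^ 2 + (49 / 216 + 10 / 3) * τ + (-5 / 6) := by
    intro τ hτ
    have h0 : 0 < τ := by linarith [hτ.1]
    -- The slice crosses the bisector of p and q, the line with first coordinate 1/2, at s = (2τ -
    -- 1)/τ. By symmetry it leaves the cell of p at 1 minus this value, and the cell disappears from
    -- the slice at τ = 2/3.
    have hu0 : 0 ≤ (2 * τ - 1) / τ := div_nonneg (by linarith [hτ.1]) h0.le
    have hu1 : (2 * τ - 1) / τ ≤ 1 / 2 := by
      rw [div_le_iff₀ h0]; linarith [hτ.2]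
    set u := (2 * τ - 1) / τ with hu
    have hut : u * τ = 2 * τ - 1 := by rw [hu]; field_simp
    have i1 := integral_le_of_le_quadratic (hf τ) hu0 (hQ τ)
    have i2 := integral_le_of_le_quadratic (hf τ) (show u ≤ 1 - u by linarith) (hP τ)
    have i3 := integral_le_of_le_quadratic (hf τ) (show 1 - u ≤ 1 by linarith) (hR τ)
    have hs := integral_split_three (hf τ) 0 u (1 - u) 1
    have h2 := mul_le_mul_of_nonneg_left (hs.trans_le (add_le_add (add_le_add i1 i2) i3))
      (show 0 ≤ 2 * τ by linarith)
    refine h2.trans_eq ?_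
    linear_combination (5 / 6 * (u * τ + 2 * τ - 1) - (5 / 3) * (2 * τ - 1)) * hut
  have e3 : ∀ τ ∈ Set.Icc (2/3:ℝ) 1, 2 * τ * g τ ≤
      5 / 3 * τ ^ 3 + (-7 / 6 - 35 / 24) * τ ^ 2 + (49 / 216 + 5 / 6) * τ + 0 := by
    intro τ hτ
    have i1 := integral_le_of_le_quadratic (hf τ) (show (0:ℝ) ≤ 1 / 2 by norm_num) (hQ τ)
    have i3 := integral_le_of_le_quadratic (hf τ) (show (1:ℝ) / 2 ≤ 1 by norm_num) (hR τ)
    have hs := intervalIntegral.integral_add_adjacent_intervals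
      ((hf τ).intervalIntegrable (μ := volume) 0 (1/2))
      ((hf τ).intervalIntegrable (μ := volume) (1/2) 1)
    have h2 := mul_le_mul_of_nonneg_left (hs.symm.trans_le (add_le_add i1 i3))
      (show 0 ≤ 2 * τ by linarith [hτ.1])
    refine h2.trans_eq ?_
    ring
  rw [meanDistSq, integral_uniformTriangle_eq_coneMean_OAB hc]
  change ∫ τ in (0:ℝ)..1, 2 * τ * g τ ≤ _
  rw [integral_split_three hk 0 (1/2) (2/3) 1]
  refine (add_le_add (add_le_add (integral_le_of_le_cubic hk (by norm_num) e1)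
    (integral_le_of_le_cubic hk (by norm_num) e2))
    (integral_le_of_le_cubic hk (by norm_num) e3)).trans ?_
  norm_num

/-- Stationarity of an optimal triple under homotheties about its circumcentre. -/
theorem meanDistSq_eq_of_circumcenter {a b c V : Plane} {S : ℝ}
    (hmin : ∀ a' b' c', meanDistSq a b c ≤ meanDistSq a' b' c')
    (ha : distSq a V = S) (hb : distSq b V = S) (hc : distSq c V = S) :
    meanDistSq a b c = 1 / 12 + ((V 0 - 1 / 2) ^ 2 + (V 1 - √3 / 6) ^ 2) - S := by
  rw [← integral_distSq V]
  set D := meanDistSq a b c with hD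
  set A := ∫ x, distSq V x ∂uniformTriangle with hA
  -- The correction (t² - t)S is the same for all three points because they are equidistant from V,
  -- so the minimum is attained at the same point as before. Stationarity at t = 1 reads D + S = A.
  have h1 : ∀ t : ℝ, ∀ e x : Plane, distSq e V = S → distSq (V + t • (e - V)) x =
      (1 - t) * distSq V x + t * distSq e x + (t ^ 2 - t) * S := by
    intro t e x he
    rw [← he]
    simp [distSq]
    ring
  have h2 : ∀ t : ℝ, 0 ≤ t → D ≤ (1 - t) * A + t * D + (t ^ 2 - t) * S := by
    intro t ht
    have h3 := hmin (V + t • (a - V)) (V + t • (b - V)) (V + t • (c - V))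
    refine h3.trans_eq ?_
    have h4 : ∀ x, minDistSq (V + t • (a - V)) (V + t • (b - V)) (V + t • (c - V)) x =
        ((1 - t) * distSq V x + t * minDistSq a b c x) + (t ^ 2 - t) * S := by
      intro x
      rw [minDistSq, h1 t a x ha, h1 t b x hb, h1 t c x hc, min_add_add_right,
        min_add_add_left, min_add_add_right, min_add_add_left, minDistSq,
        mul_min_of_nonneg _ _ ht, mul_min_of_nonneg _ _ ht]
    have i1 := (integrable_uniformTriangle (continuous_distSq V)).const_mul (1 - t)
    have i2 := (integrable_uniformTriangle (continuous_minDistSq a b c)).const_mul t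
    rw [meanDistSq]
    simp only [h4]
    have i3 : Integrable (fun x => (1 - t) * distSq V x + t * minDistSq a b c x)
        uniformTriangle := i1.add i2
    rw [integral_add i3 (integrable_const _), integral_add i1 i2, integral_const_mul,
      integral_const_mul, integral_const]
    simp [hA, hD, meanDistSq]
  have h5 : IsLocalMin (fun t : ℝ => (1 - t) * A + t * D + (t ^ 2 - t) * S) 1 := by
    filter_upwards [lt_mem_nhds (show (0:ℝ) < 1 by norm_num)] with t ht
    have := h2 t ht.le
    linarith
  have h6 : HasDerivAt (fun t : ℝ => (1 - t) * A + t * D + (t ^ 2 - t) * S)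
      ((0 - 1) * A + 1 * D + (((2:ℕ) : ℝ) * 1 ^ (2 - 1) * 1 - 1) * S) 1 := by
    have hid := hasDerivAt_id (1:ℝ)
    exact ((((hasDerivAt_const _ _).sub hid).mul_const A).add (hid.mul_const D)).add
      (((hid.pow 2).sub hid).mul_const S)
  have h7 := h5.hasDerivAt_eq_zero h6
  norm_num at h7
  linarith

/-- A triple contained in a line has mean squared distance at least `1/24`. -/
theorem one_le_meanDistSq_of_collinear {a b c : Plane} {α β γ : ℝ} (h : α ^ 2 + β ^ 2 ≠ 0)
    (ha : α * a 0 + β * a 1 + γ = 0) (hb : α * b 0 + β * b 1 + γ = 0)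
    (hc : α * c 0 + β * c 1 + γ = 0) : 1 / 24 ≤ meanDistSq a b c := by
  have hN : 0 < α ^ 2 + β ^ 2 := lt_of_le_of_ne (by positivity) h.symm
  have h1 : ∀ e x : Plane, α * e 0 + β * e 1 + γ = 0 →
      (α * x 0 + β * x 1 + γ) ^ 2 ≤ (α ^ 2 + β ^ 2) * distSq e x := by
    intro e x he
    have : α * x 0 + β * x 1 + γ = α * (x 0 - e 0) + β * (x 1 - e 1) := by linarith
    rw [this, distSq]
    nlinarith [sq_nonneg (α * (x 1 - e 1) - β * (x 0 - e 0))]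
  have h2 : ∫ x : Plane, (α * x 0 + β * x 1 + γ) ^ 2 ∂uniformTriangle ≤
      ∫ x, (α ^ 2 + β ^ 2) * minDistSq a b c x ∂uniformTriangle := by
    refine integral_mono (integrable_uniformTriangle (by fun_prop))
      ((integrable_uniformTriangle (continuous_minDistSq a b c)).const_mul _) fun x => ?_
    simp only [minDistSq]
    rw [mul_min_of_nonneg _ _ hN.le, mul_min_of_nonneg _ _ hN.le]
    exact le_min (h1 _ _ ha) (le_min (h1 _ _ hb) (h1 _ _ hc))
  rw [integral_affine_sq, integral_const_mul, ← meanDistSq] at h2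
  have h3 : (α ^ 2 + β ^ 2) * (1 / 24) ≤ (α ^ 2 + β ^ 2) * meanDistSq a b c := by
    nlinarith [sq_nonneg (α / 2 + β * (√3 / 6) + γ)]
  exact le_of_mul_le_mul_left h3 hN

end Quantization

/-! ### Decomposition of an edge into cells -/

namespace Quantization

/-- The integral of a minimum of three functions over `[0, 1]`, where the third one never is
strictly the smallest. -/
theorem exists_integral_min_two {f g k : ℝ → ℝ} (hf : Continuous f) (hg : Continuous g)
    {α β : ℝ} (hfg : ∀ s, f s - g s = α * s + β) (h0 : f 0 ≤ g 0) (h1 : g 1 ≤ f 1)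
    (hk : ∀ s ∈ Set.Icc (0:ℝ) 1, min (f s) (g s) ≤ k s) :
    ∃ d, 0 ≤ d ∧ d ≤ 1 ∧ f d = g d ∧
      ∫ s in (0:ℝ)..1, min (f s) (min (g s) (k s)) =
        (∫ s in (0:ℝ)..d, f s) + ∫ s in d..1, g s := by
  have hβ : β ≤ 0 := by linarith [hfg 0]
  have hαβ : 0 ≤ α + β := by linarith [hfg 1]
  have hα : 0 ≤ α := by linarith
  obtain ⟨d, hd0, hd1, hd⟩ : ∃ d, 0 ≤ d ∧ d ≤ 1 ∧ α * d + β = 0 := by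
    rcases hα.eq_or_lt with h | h
    -- Here β = 0 as well, so f = g and any break point would serve.
    · exact ⟨0, le_rfl, zero_le_one, by linarith⟩
    · refine ⟨-β / α, div_nonneg (by linarith) h.le, ?_, by field_simp; ring⟩
      rw [div_le_one h]; linarith
  refine ⟨d, hd0, hd1, by linarith [hfg d], ?_⟩
  have hm : ∀ s ∈ Set.Icc (0:ℝ) 1, min (f s) (min (g s) (k s)) = min (f s) (g s) := by
    intro s hs
    rw [← min_assoc, min_eq_left (hk s hs)]
  have e0 : ∫ s in (0:ℝ)..1, min (f s) (min (g s) (k s)) = ∫ s in (0:ℝ)..1, min (f s) (g s) := by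
    refine intervalIntegral.integral_congr fun s hs => hm s ?_
    rwa [Set.uIcc_of_le zero_le_one] at hs
  have e1 : ∫ s in (0:ℝ)..d, min (f s) (g s) = ∫ s in (0:ℝ)..d, f s := by
    refine intervalIntegral.integral_congr fun s hs => ?_
    rw [Set.uIcc_of_le hd0] at hs
    exact min_eq_left (by nlinarith [hfg s, mul_le_mul_of_nonneg_left hs.2 hα])
  have e2 : ∫ s in d..1, min (f s) (g s) = ∫ s in d..1, g s := by
    refine intervalIntegral.integral_congr fun s hs => ?_
    rw [Set.uIcc_of_le hd1] at hs
    exact min_eq_right (by nlinarith [hfg s, mul_le_mul_of_nonneg_left hs.1 hα])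
  have hc : Continuous fun s => min (f s) (g s) := hf.min hg
  rw [e0, ← e1, ← e2, intervalIntegral.integral_add_adjacent_intervals
    (hc.intervalIntegrable _ _) (hc.intervalIntegrable _ _)]

/-- The integral of a minimum of three functions over `[0, 1]`, where the third one somewhere is
strictly the smallest. -/
theorem exists_integral_min_three {f g k : ℝ → ℝ} (hf : Continuous f) (hg : Continuous g)
    (hk : Continuous k) {α β α' β' : ℝ} (hfk : ∀ s, f s - k s = α * s + β)
    (hkg : ∀ s, k s - g s = α' * s + β') (h0 : f 0 ≤ k 0) (h1 : g 1 ≤ k 1)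
    {σ : ℝ} (hσ : σ ∈ Set.Icc (0:ℝ) 1) (hσf : k σ < f σ) (hσg : k σ < g σ) :
    ∃ d e, 0 ≤ d ∧ d ≤ e ∧ e ≤ 1 ∧
      ∫ s in (0:ℝ)..1, min (f s) (min (g s) (k s)) =
        (∫ s in (0:ℝ)..d, f s) + (∫ s in d..e, k s) + ∫ s in e..1, g s := by
  obtain ⟨hσ0, hσ1⟩ := hσ
  have hβ : β ≤ 0 := by linarith [hfk 0]
  have a1 : 0 < α * σ + β := by linarith [hfk σ]
  have a2 : α' * σ + β' < 0 := by linarith [hkg σ]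
  have a3 : 0 ≤ α' + β' := by linarith [hkg 1]
  have hα : 0 < α := by
    by_contra h
    nlinarith [mul_nonneg (sub_nonneg.2 (not_lt.1 h)) hσ0]
  have hα' : 0 < α' := by
    by_contra h
    nlinarith [mul_nonneg (sub_nonneg.2 (not_lt.1 h)) (sub_nonneg.2 hσ1)]
  have hd : α * (-β / α) + β = 0 := by field_simp; ring
  have he : α' * (-β' / α') + β' = 0 := by field_simp; ring
  have hd0 : 0 ≤ -β / α := div_nonneg (by linarith) hα.le
  have he1 : -β' / α' ≤ 1 := by rw [div_le_one hα']; linarith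
  set d := -β / α
  set e := -β' / α'
  have hdσ : d < σ := lt_of_mul_lt_mul_left (show α * d < α * σ by linarith) hα.le
  have hσe : σ < e := lt_of_mul_lt_mul_left (show α' * σ < α' * e by linarith) hα'.le
  have hde : d ≤ e := (hdσ.trans hσe).le
  refine ⟨d, e, hd0, hde, he1, ?_⟩
  have hc : Continuous fun s => min (f s) (min (g s) (k s)) := hf.min (hg.min hk)
  have e1 : ∫ s in (0:ℝ)..d, min (f s) (min (g s) (k s)) = ∫ s in (0:ℝ)..d, f s := by
    refine intervalIntegral.integral_congr fun s hs => ?_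
    rw [Set.uIcc_of_le hd0] at hs
    have b1 : f s ≤ k s := by nlinarith [hfk s, mul_le_mul_of_nonneg_left hs.2 hα.le]
    have b2 : k s ≤ g s := by
      nlinarith [hkg s, mul_le_mul_of_nonneg_left (hs.2.trans hde) hα'.le]
    exact min_eq_left (le_min (b1.trans b2) b1)
  have e2 : ∫ s in d..e, min (f s) (min (g s) (k s)) = ∫ s in d..e, k s := by
    refine intervalIntegral.integral_congr fun s hs => ?_
    rw [Set.uIcc_of_le hde] at hs
    have b1 : k s ≤ f s := by nlinarith [hfk s, mul_le_mul_of_nonneg_left hs.1 hα.le]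
    have b2 : k s ≤ g s := by nlinarith [hkg s, mul_le_mul_of_nonneg_left hs.2 hα'.le]
    simp only [min_eq_right b2, min_eq_right b1]
  have e3 : ∫ s in e..1, min (f s) (min (g s) (k s)) = ∫ s in e..1, g s := by
    refine intervalIntegral.integral_congr fun s hs => ?_
    rw [Set.uIcc_of_le he1] at hs
    have b1 : k s ≤ f s := by
      nlinarith [hfk s, mul_le_mul_of_nonneg_left (hde.trans hs.1) hα.le]
    have b2 : g s ≤ k s := by nlinarith [hkg s, mul_le_mul_of_nonneg_left hs.1 hα'.le]
    simp only [min_eq_left b2, min_eq_right (b2.trans b1)]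
  rw [integral_split_three hc 0 d e 1, e1, e2, e3]

/-- The squared distance from the point with frame coordinates `p₁, p₂` relative to the
circumcentre to the point with parameter `s` on an edge; `x, y` describe the circumcentre. -/
noncomputable def edgeDistSq (x y p₁ p₂ s : ℝ) : ℝ :=
  (s - 1 / 2 - y * √3 / 6 - p₁) ^ 2 + ((1 - x) * √3 / 6 + p₂) ^ 2

theorem continuous_edgeDistSq (x y p₁ p₂ : ℝ) : Continuous (edgeDistSq x y p₁ p₂) := by
  unfold edgeDistSq; fun_prop

theorem edgeDistSq_sub {x y p₁ p₂ q₁ q₂ S : ℝ} (hp : p₁ ^ 2 + p₂ ^ 2 = S)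
    (hq : q₁ ^ 2 + q₂ ^ 2 = S) (s : ℝ) :
    edgeDistSq x y p₁ p₂ s - edgeDistSq x y q₁ q₂ s =
      (2 * (q₁ - p₁)) * s +
        ((2 * (q₁ - p₁)) * (-1 / 2 - y * √3 / 6) + 2 * ((1 - x) * √3 / 6) * (p₂ - q₂)) := by
  unfold edgeDistSq
  linear_combination hp - hq

theorem integral_edgeDistSq {x y p₁ p₂ S : ℝ} (hp : p₁ ^ 2 + p₂ ^ 2 = S) (d e : ℝ) :
    ∫ s in (d + 1 / 2)..(e + 1 / 2), edgeDistSq x y p₁ p₂ s =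
      (e ^ 3 - d ^ 3) / 3 - (y * √3 / 6) * (e ^ 2 - d ^ 2)
        + ((x ^ 2 + y ^ 2 - 2 * x + 1) / 12 + S) * (e - d)
        - 2 * (((e ^ 2 - d ^ 2) / 2 - (y * √3 / 6) * (e - d)) * p₁
          - ((1 - x) * √3 / 6) * (e - d) * p₂) := by
  have h3 : (√3 : ℝ) ^ 2 = 3 := Real.sq_sqrt (by norm_num)
  have h1 : ∀ s, edgeDistSq x y p₁ p₂ s = 1 * s ^ 2 + (-2 * (1 / 2 + y * √3 / 6 + p₁)) * s
      + ((1 / 2 + y * √3 / 6 + p₁) ^ 2 + ((1 - x) * √3 / 6 + p₂) ^ 2) := by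
    intro s; unfold edgeDistSq; ring
  simp only [h1, integral_quadratic]
  linear_combination (e - d) * hp + (y ^ 2 + (1 - x) ^ 2) / 36 * (e - d) * h3

/-- On an edge with two cells: there is a break point `d`, and the mean over the edge of the
support function is known. -/
def IsTwoCellEdge (x y S p₁ p₂ q₁ q₂ : ℝ) : Prop :=
  ∃ d, -(1 / 2) ≤ d ∧ d ≤ 1 / 2 ∧
    edgeDistSq x y p₁ p₂ (d + 1 / 2) = edgeDistSq x y q₁ q₂ (d + 1 / 2) ∧
    (3 * S - ((x ^ 2 + y ^ 2) / 12 + x / 6)) / 2 =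
      ((d ^ 2 - 1 / 4) / 2 - (y * √3 / 6) * (d + 1 / 2)) * p₁
        - ((1 - x) * √3 / 6) * (d + 1 / 2) * p₂
        + (((1 / 4 - d ^ 2) / 2 - (y * √3 / 6) * (1 / 2 - d)) * q₁
          - ((1 - x) * √3 / 6) * (1 / 2 - d) * q₂)

/-- The cases are whether the third point is ever strictly nearest on the edge. In either case,
integrating |z - V|² + S - 2⟨z - V, e - V⟩ cell by cell turns `hE` into the formula for Q, and three
cells give the weaker inequality of `edge_three_cell`. -/
theorem edge_alternative {x y S D p₁ p₂ q₁ q₂ r₁ r₂ : ℝ} (hp : p₁ ^ 2 + p₂ ^ 2 = S)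
    (hq : q₁ ^ 2 + q₂ ^ 2 = S) (hr : r₁ ^ 2 + r₂ ^ 2 = S)
    (hD : D = 1 / 12 + (x ^ 2 + y ^ 2) / 12 - S) (hD' : D ≤ 11 / 432)
    (hpq : edgeDistSq x y p₁ p₂ 0 ≤ edgeDistSq x y q₁ q₂ 0)
    (hpr : edgeDistSq x y p₁ p₂ 0 ≤ edgeDistSq x y r₁ r₂ 0)
    (hqp : edgeDistSq x y q₁ q₂ 1 ≤ edgeDistSq x y p₁ p₂ 1)
    (hqr : edgeDistSq x y q₁ q₂ 1 ≤ edgeDistSq x y r₁ r₂ 1)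
    (hE : ∫ s in (0:ℝ)..1, min (edgeDistSq x y p₁ p₂ s)
      (min (edgeDistSq x y q₁ q₂ s) (edgeDistSq x y r₁ r₂ s)) = 2 * D) :
    IsTwoCellEdge x y S p₁ p₂ q₁ q₂ ∨
      ((∃ s ∈ Set.Icc (0:ℝ) 1, edgeDistSq x y r₁ r₂ s < edgeDistSq x y p₁ p₂ s ∧
        edgeDistSq x y r₁ r₂ s < edgeDistSq x y q₁ q₂ s) ∧
      576 * x ^ 2 - 400 * x ≤ 1175 / 9 + 288 * (x ^ 2 + y ^ 2)) := by
  have hcp := continuous_edgeDistSq x y p₁ p₂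
  have hcq := continuous_edgeDistSq x y q₁ q₂
  have hcr := continuous_edgeDistSq x y r₁ r₂
  have z : (0:ℝ) = -(1/2) + 1/2 := by norm_num
  have o : (1:ℝ) = 1/2 + 1/2 := by norm_num
  by_cases h : ∀ s ∈ Set.Icc (0:ℝ) 1,
      min (edgeDistSq x y p₁ p₂ s) (edgeDistSq x y q₁ q₂ s) ≤ edgeDistSq x y r₁ r₂ s
  · left
    obtain ⟨d, hd0, hd1, hd, hI⟩ :=
      exists_integral_min_two hcp hcq (edgeDistSq_sub hp hq) hpq hqp h
    obtain ⟨d, rfl⟩ : ∃ d', d = d' + 1 / 2 := ⟨d - 1 / 2, by ring⟩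
    refine ⟨d, by linarith, by linarith, hd, ?_⟩
    have i1 : ∫ s in (0:ℝ)..(d + 1/2), edgeDistSq x y p₁ p₂ s = _ :=
      (congrArg (fun u => ∫ s in u..(d + 1/2), edgeDistSq x y p₁ p₂ s) z).trans
        (integral_edgeDistSq hp _ _)
    have i2 : ∫ s in (d + 1/2)..1, edgeDistSq x y q₁ q₂ s = _ :=
      (congrArg (fun u => ∫ s in (d + 1/2)..u, edgeDistSq x y q₁ q₂ s) o).trans
        (integral_edgeDistSq hq _ _)
    rw [hE, i1, i2, hD] at hI
    linear_combination (-1 / 2) * hI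
  · right
    push Not at h
    obtain ⟨σ, hσ, hlt⟩ := h
    rw [lt_min_iff] at hlt
    refine ⟨⟨σ, hσ, hlt⟩, ?_⟩
    obtain ⟨d, e, hd0, hde, he1, hI⟩ := exists_integral_min_three hcp hcq hcr
      (edgeDistSq_sub hp hr) (edgeDistSq_sub hr hq) hpr hqr hσ hlt.1 hlt.2
    obtain ⟨d, rfl⟩ : ∃ d', d = d' + 1 / 2 := ⟨d - 1 / 2, by ring⟩
    obtain ⟨e, rfl⟩ : ∃ d', e = d' + 1 / 2 := ⟨e - 1 / 2, by ring⟩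
    have i1 : ∫ s in (0:ℝ)..(d + 1/2), edgeDistSq x y p₁ p₂ s = _ :=
      (congrArg (fun u => ∫ s in u..(d + 1/2), edgeDistSq x y p₁ p₂ s) z).trans
        (integral_edgeDistSq hp _ _)
    have i2 : ∫ s in (e + 1/2)..1, edgeDistSq x y q₁ q₂ s = _ :=
      (congrArg (fun u => ∫ s in (e + 1/2)..u, edgeDistSq x y q₁ q₂ s) o).trans
        (integral_edgeDistSq hq _ _)
    rw [hE, i1, i2, integral_edgeDistSq hr, hD] at hI
    refine edge_three_cell (d := d) (e := e) (S := S)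
      (Q := (3 * S - ((x ^ 2 + y ^ 2) / 12 + x / 6)) / 2) (by linarith) (by linarith)
      (by linarith) hp hr hq (by linarith) rfl ?_
    linear_combination (-1 / 2) * hI

end Quantization

/-! ### Consequences of the edge inequalities for the circumcentre -/

namespace Quantization

/-- Everything later needed from a two-cell edge, for δ = √3 d: the bound on the break point, the
exact equations when the break is the midpoint, and the quadratic inequality in κ. -/
theorem IsTwoCellEdge.exists_offset {x y S p₁ p₂ q₁ q₂ : ℝ}
    (h : IsTwoCellEdge x y S p₁ p₂ q₁ q₂) (hp : p₁ ^ 2 + p₂ ^ 2 = S) (hq : q₁ ^ 2 + q₂ ^ 2 = S)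
    (hS : 25 / 432 + (x ^ 2 + y ^ 2) / 12 ≤ S) :
    ∃ δ, (1200 + 1728 * (x ^ 2 + y ^ 2)) * δ ^ 2 ≤
        3 * (75 + 208 * (x ^ 2 + y ^ 2) - 576 * x ^ 2 + 400 * x) ∧
      (δ = 0 → edgeDistSq x y p₁ p₂ (1 / 2) = edgeDistSq x y q₁ q₂ (1 / 2) ∧
        (3 * S - ((x ^ 2 + y ^ 2) / 12 + x / 6)) / 2 =
          (-1 / 8 - y * √3 / 12) * p₁ - (1 - x) * √3 / 12 * p₂
            + (1 / 8 - y * √3 / 12) * q₁ - (1 - x) * √3 / 12 * q₂) ∧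
      ∀ k κ : ℝ, κ = √3 * k → (p₁ * q₁ + p₂ * q₂) * (1 + k ^ 2) = S * (k ^ 2 - 1) →
        (p₁ * q₂ - p₂ * q₁) * (1 + k ^ 2) = 2 * k * S →
        (225 + 224 * (x ^ 2 + y ^ 2) + 576 * x ^ 2 - 400 * x) * (κ ^ 2 + 3)
          - (1200 + 1728 * (x ^ 2 + y ^ 2)) * (1 - x) * (1 - 4 / 3 * δ ^ 2) * κ
          + (1200 + 1728 * (x ^ 2 + y ^ 2)) * ((x ^ 2 + y ^ 2) - 2 * x + 1
            - 3 / 4 * (1 - 4 / 3 * (δ * (δ - y))) ^ 2 - 4 / 3 * (1 - x) ^ 2 * δ ^ 2) ≤ 0 := by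
  have h3 : (√3 : ℝ) ^ 2 = 3 := Real.sq_sqrt (by norm_num)
  obtain ⟨d, hd, hd', hbreak, hQ⟩ := h
  have hδ : d = (√3 * d) * √3 / 3 := by linear_combination (-d / 3) * h3
  refine ⟨√3 * d, edge_two_cell hd hd' hδ hp hq hS rfl hQ, ?_, ?_⟩
  · intro h0
    obtain rfl : d = 0 := by
      rcases mul_eq_zero.1 h0 with h | h
      · exact absurd h (by positivity)
      · exact h
    rw [zero_add] at hbreak
    refine ⟨hbreak, ?_⟩
    linear_combination hQ
  · intro k κ hκ hc hs
    exact edge_quadratic_nonpos hδ hκ hp hq hc hs hS rfl hQ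

theorem IsTwoCellEdge.normal_coord_bound {x y S p₁ p₂ q₁ q₂ : ℝ}
    (h : IsTwoCellEdge x y S p₁ p₂ q₁ q₂) (hp : p₁ ^ 2 + p₂ ^ 2 = S) (hq : q₁ ^ 2 + q₂ ^ 2 = S)
    (hS : 25 / 432 + (x ^ 2 + y ^ 2) / 12 ≤ S) :
    576 * x ^ 2 - 400 * x ≤ 75 + 208 * (x ^ 2 + y ^ 2) := by
  obtain ⟨δ, hδ, -⟩ := h.exists_offset hp hq hS
  have : 0 ≤ (1200 + 1728 * (x ^ 2 + y ^ 2)) * δ ^ 2 := by positivity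
  linarith

/-- The inscribed angle theorem, in terms of the cotangent `k` of the inscribed angle. -/
theorem inscribed_angle {a₁ a₂ b₁ b₂ c₁ c₂ S k : ℝ} (ha : a₁ ^ 2 + a₂ ^ 2 = S)
    (hb : b₁ ^ 2 + b₂ ^ 2 = S) (hc : c₁ ^ 2 + c₂ ^ 2 = S)
    (hcr : (a₁ - c₁) * (b₂ - c₂) - (a₂ - c₂) * (b₁ - c₁) ≠ 0)
    (hk : (a₁ - c₁) * (b₁ - c₁) + (a₂ - c₂) * (b₂ - c₂) =
      k * ((a₁ - c₁) * (b₂ - c₂) - (a₂ - c₂) * (b₁ - c₁))) :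
    (a₁ * b₁ + a₂ * b₂) * (1 + k ^ 2) = S * (k ^ 2 - 1) ∧
      (a₁ * b₂ - a₂ * b₁) * (1 + k ^ 2) = 2 * k * S := by
  set cr := (a₁ - c₁) * (b₂ - c₂) - (a₂ - c₂) * (b₁ - c₁) with hcr'
  set u := a₁ * b₁ + a₂ * b₂ with hu
  set v := a₁ * b₂ - a₂ * b₁ with hv
  have e1 : u * (k * cr) + v * cr = S * (k * cr) := by
    rw [← hk, hcr', hu, hv]
    linear_combination (b₁ ^ 2 + b₂ ^ 2 - (b₁ * c₁ + b₂ * c₂)) * ha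
      + (S - (a₁ * c₁ + a₂ * c₂)) * hb + (a₁ * b₁ + a₂ * b₂ - S) * hc
  have e2 : v * (k * cr) - u * cr = S * cr := by
    rw [← hk, hcr', hu, hv]
    linear_combination (b₁ * c₂ - b₂ * c₁) * ha + (c₁ * a₂ - c₂ * a₁) * hb
      + (a₁ * b₂ - a₂ * b₁) * hc
  have f1 : u * k + v = S * k := mul_right_cancel₀ hcr (by linear_combination e1)
  have f2 : v * k - u = S := mul_right_cancel₀ hcr (by linear_combination e2)
  constructor
  · linear_combination k * f1 - f2
  · linear_combination f1 + k * f2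

/-- If an edge has three cells, the circumcentre lies beyond that edge or beyond the opposite
vertex. The unknowns are the squared distances of the three points to the three vertices. -/
theorem circumcenter_location {x₀ x₁ x₂ aO aA aB bO bA bB cO cA cB s : ℝ}
    (hs0 : 0 ≤ s) (hs1 : s ≤ 1)
    (haO : aO ≤ cO) (hbA : bA ≤ cA) (hca : cB ≤ aB) (hcb : cB ≤ bB)
    (hVa : (1 - x₁) * (cO - aO) + (1 - x₂) * (cA - aA) + (1 - x₀) * (cB - aB) = 0)
    (hVb : (1 - x₁) * (cO - bO) + (1 - x₂) * (cA - bA) + (1 - x₀) * (cB - bB) = 0)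
    (ha : (1 - s) * (cO - aO) + s * (cA - aA) < 0) (hb : (1 - s) * (cO - bO) + s * (cA - bA) < 0) :
    1 ≤ x₀ ∨ (1 ≤ x₁ ∧ 1 ≤ x₂) := by
  have hA : cA - aA < 0 := by
    by_contra h
    nlinarith [mul_nonneg (sub_nonneg.2 hs1) (sub_nonneg.2 haO), mul_nonneg hs0 (not_lt.1 h)]
  have hO : cO - bO < 0 := by
    by_contra h
    nlinarith [mul_nonneg hs0 (sub_nonneg.2 hbA), mul_nonneg (sub_nonneg.2 hs1) (not_lt.1 h)]
  by_contra hcon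
  rw [not_or, not_and_or, not_le, not_le, not_le] at hcon
  obtain ⟨h0, h12⟩ := hcon
  have hν : 0 < 1 - x₀ := by linarith
  have hνa : 0 ≤ (1 - x₀) * (aB - cB) := mul_nonneg hν.le (by linarith)
  have hνb : 0 ≤ (1 - x₀) * (bB - cB) := mul_nonneg hν.le (by linarith)
  have hboth : 0 < 1 - x₁ ∧ 0 < 1 - x₂ := by
    rcases h12 with h | h
    · refine ⟨by linarith, ?_⟩
      by_contra h2
      nlinarith [mul_pos (show 0 < 1 - x₁ by linarith) (neg_pos.2 hO),
        mul_nonneg (sub_nonneg.2 (not_lt.1 h2)) (sub_nonneg.2 hbA)]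
    · refine ⟨?_, by linarith⟩
      by_contra h2
      nlinarith [mul_pos (show 0 < 1 - x₂ by linarith) (neg_pos.2 hA),
        mul_nonneg (sub_nonneg.2 (not_lt.1 h2)) (sub_nonneg.2 haO)]
  obtain ⟨hl, hm⟩ := hboth
  -- V is now on the inner side of all three edge lines. Projecting it from B to the edge OA gives a
  -- parameter which is less than s by comparing c with a, and greater than s by comparing c with b.
  have k1 : (1 - x₂) * (aA - cA) ≤ (1 - x₁) * (cO - aO) := by linarith
  have k2 : (1 - x₁) * (bO - cO) ≤ (1 - x₂) * (cA - bA) := by linarith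
  have l1 : ((1 - x₂) * (1 - s)) * (aA - cA) < ((1 - x₁) * s) * (aA - cA) := by
    nlinarith [mul_le_mul_of_nonneg_left k1 (sub_nonneg.2 hs1)]
  have l2 : ((1 - x₁) * s) * (bO - cO) < ((1 - x₂) * (1 - s)) * (bO - cO) := by
    nlinarith [mul_le_mul_of_nonneg_left k2 hs0]
  have m1 := lt_of_mul_lt_mul_right l1 (by linarith)
  have m2 := lt_of_mul_lt_mul_right l2 (by linarith)
  linarith

/-- If all edges have two cells, then the circumcentre is the centroid. -/
theorem circumcenter_eq_centroid {x₁ x₂ x₃ y₁ y₂ y₃ w κ₁ κ₂ κ₃ δ₁ δ₂ δ₃ : ℝ}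
    (hs : x₁ + x₂ + x₃ = 0) (hw : w = 2 / 3 * (x₁ ^ 2 + x₂ ^ 2 + x₃ ^ 2))
    (hw₁ : x₁ ^ 2 + y₁ ^ 2 = w) (hw₂ : x₂ ^ 2 + y₂ ^ 2 = w) (hw₃ : x₃ ^ 2 + y₃ ^ 2 = w)
    (hδ₁ : (1200 + 1728 * (x₁ ^ 2 + y₁ ^ 2)) * δ₁ ^ 2 ≤
      3 * (75 + 208 * (x₁ ^ 2 + y₁ ^ 2) - 576 * x₁ ^ 2 + 400 * x₁))
    (hδ₂ : (1200 + 1728 * (x₂ ^ 2 + y₂ ^ 2)) * δ₂ ^ 2 ≤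
      3 * (75 + 208 * (x₂ ^ 2 + y₂ ^ 2) - 576 * x₂ ^ 2 + 400 * x₂))
    (hδ₃ : (1200 + 1728 * (x₃ ^ 2 + y₃ ^ 2)) * δ₃ ^ 2 ≤
      3 * (75 + 208 * (x₃ ^ 2 + y₃ ^ 2) - 576 * x₃ ^ 2 + 400 * x₃))
    (hψ₁ : (225 + 224 * (x₁ ^ 2 + y₁ ^ 2) + 576 * x₁ ^ 2 - 400 * x₁) * (κ₁ ^ 2 + 3)
      - (1200 + 1728 * (x₁ ^ 2 + y₁ ^ 2)) * (1 - x₁) * (1 - 4 / 3 * δ₁ ^ 2) * κ₁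
      + (1200 + 1728 * (x₁ ^ 2 + y₁ ^ 2)) * ((x₁ ^ 2 + y₁ ^ 2) - 2 * x₁ + 1
        - 3 / 4 * (1 - 4 / 3 * (δ₁ * (δ₁ - y₁))) ^ 2 - 4 / 3 * (1 - x₁) ^ 2 * δ₁ ^ 2) ≤ 0)
    (hψ₂ : (225 + 224 * (x₂ ^ 2 + y₂ ^ 2) + 576 * x₂ ^ 2 - 400 * x₂) * (κ₂ ^ 2 + 3)
      - (1200 + 1728 * (x₂ ^ 2 + y₂ ^ 2)) * (1 - x₂) * (1 - 4 / 3 * δ₂ ^ 2) * κ₂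
      + (1200 + 1728 * (x₂ ^ 2 + y₂ ^ 2)) * ((x₂ ^ 2 + y₂ ^ 2) - 2 * x₂ + 1
        - 3 / 4 * (1 - 4 / 3 * (δ₂ * (δ₂ - y₂))) ^ 2 - 4 / 3 * (1 - x₂) ^ 2 * δ₂ ^ 2) ≤ 0)
    (hψ₃ : (225 + 224 * (x₃ ^ 2 + y₃ ^ 2) + 576 * x₃ ^ 2 - 400 * x₃) * (κ₃ ^ 2 + 3)
      - (1200 + 1728 * (x₃ ^ 2 + y₃ ^ 2)) * (1 - x₃) * (1 - 4 / 3 * δ₃ ^ 2) * κ₃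
      + (1200 + 1728 * (x₃ ^ 2 + y₃ ^ 2)) * ((x₃ ^ 2 + y₃ ^ 2) - 2 * x₃ + 1
        - 3 / 4 * (1 - 4 / 3 * (δ₃ * (δ₃ - y₃))) ^ 2 - 4 / 3 * (1 - x₃) ^ 2 * δ₃ ^ 2) ≤ 0)
    (hκ : κ₁ * κ₂ + κ₂ * κ₃ + κ₃ * κ₁ = 3) :
    x₁ = 0 ∧ x₂ = 0 ∧ κ₁ = 1 ∧ κ₂ = 1 ∧ δ₁ = 0 := by
  have hw0 : 0 ≤ 1200 + 1728 * w := by rw [← hw₁]; positivity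
  rw [hw₁] at hδ₁ hψ₁
  rw [hw₂] at hδ₂ hψ₂
  rw [hw₃] at hδ₃ hψ₃
  obtain ⟨g₁, g₂, g₃⟩ := coords_bound hs hw
    (by linarith [mul_nonneg hw0 (sq_nonneg δ₁)]) (by linarith [mul_nonneg hw0 (sq_nonneg δ₂)])
    (by linarith [mul_nonneg hw0 (sq_nonneg δ₃)])
  have hwle : w ≤ 121 / 625 := hw.trans_le (coord_energy_le hs g₁ g₂ g₃)
  rw [← hw₁] at hδ₁ hψ₁
  rw [← hw₂] at hδ₂ hψ₂
  rw [← hw₃] at hδ₃ hψ₃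
  have c₁ := comparison_le_of_edge_quadratic g₁ (by linarith) (hw₁.trans_le hwle) hδ₁ hψ₁
  have c₂ := comparison_le_of_edge_quadratic g₂ (by linarith) (hw₂.trans_le hwle) hδ₂ hψ₂
  have c₃ := comparison_le_of_edge_quadratic g₃ (by linarith) (hw₃.trans_le hwle) hδ₃ hψ₃
  obtain ⟨rfl, rfl, rfl⟩ := comparison_sum hs g₁ g₂ g₃ c₁ c₂ c₃ hκ
  have hw00 : w = 0 := by rw [hw]; norm_num
  have d₁ : 1 ≤ κ₁ := by linarith
  have d₂ : 1 ≤ κ₂ := by linarith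
  have d₃ : 1 ≤ κ₃ := by linarith
  -- All κ are at least 1 and their pairwise products sum to 3, so all are 1.
  have m12 := mul_le_mul_of_nonneg_left d₂ (show 0 ≤ κ₁ by linarith)
  have m12' := mul_le_mul_of_nonneg_left d₁ (show 0 ≤ κ₂ by linarith)
  have m23 := mul_le_mul d₂ d₃ zero_le_one (by linarith)
  have m31 := mul_le_mul d₃ d₁ zero_le_one (by linarith)
  have k₁ : κ₁ = 1 := by linarith
  have k₂ : κ₂ = 1 := by linarith
  have hy : y₁ = 0 := by
    rw [hw00] at hw₁
    exact pow_eq_zero_iff two_ne_zero |>.1 (by linarith)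
  refine ⟨rfl, rfl, k₁, k₂, ?_⟩
  rw [k₁, hy] at hψ₁
  rw [hy] at hδ₁
  have h1 : δ₁ ^ 2 ≤ 3 / 16 := by linarith
  have h2 : δ₁ ^ 2 * (3 / 2 - δ₁ ^ 2) ≤ 0 := by linear_combination (1 / 1600) * hψ₁
  have h3 : δ₁ ^ 2 ≤ 0 := nonpos_of_mul_nonpos_left h2 (by linarith)
  exact pow_eq_zero_iff two_ne_zero |>.1 (le_antisymm h3 (sq_nonneg _))

end Quantization

/-! ### Edges of the triangle in frame coordinates -/

namespace Quantization

theorem distSq_sub_lineMap (a b q r : Plane) (s : ℝ) :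
    distSq a ((1 - s) • q + s • r) - distSq b ((1 - s) • q + s • r) =
      (1 - s) * (distSq a q - distSq b q) + s * (distSq a r - distSq b r) := by
  simp only [distSq, PiLp.add_apply, PiLp.smul_apply, smul_eq_mul]
  ring

/-- The squared distance to points of the edge with direction `(t₀, t₁)`, in frame coordinates. -/
theorem distSq_edge {t₀ t₁ x y : ℝ} {a q r V : Plane} (ht : t₀ ^ 2 + t₁ ^ 2 = 1)
    (hq₀ : q 0 = 1 / 2 + √3 / 6 * t₁ - t₀ / 2) (hq₁ : q 1 = √3 / 6 - √3 / 6 * t₀ - t₁ / 2)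
    (hr₀ : r 0 = 1 / 2 + √3 / 6 * t₁ + t₀ / 2) (hr₁ : r 1 = √3 / 6 - √3 / 6 * t₀ + t₁ / 2)
    (hV₀ : V 0 = 1 / 2 + √3 / 6 * (y * t₀ + x * t₁))
    (hV₁ : V 1 = √3 / 6 + √3 / 6 * (y * t₁ - x * t₀)) (s : ℝ) :
    distSq a ((1 - s) • q + s • r) =
      edgeDistSq x y ((a 0 - V 0) * t₀ + (a 1 - V 1) * t₁)
        ((a 1 - V 1) * t₀ - (a 0 - V 0) * t₁) s := by
  obtain ⟨A₀, hA₀⟩ : ∃ A₀, A₀ = a 0 - V 0 := ⟨_, rfl⟩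
  obtain ⟨A₁, hA₁⟩ : ∃ A₁, A₁ = a 1 - V 1 := ⟨_, rfl⟩
  have ha₀ : a 0 = V 0 + A₀ := by linarith
  have ha₁ : a 1 = V 1 + A₁ := by linarith
  simp only [distSq, PiLp.add_apply, PiLp.smul_apply, smul_eq_mul, ha₀, ha₁, add_sub_cancel_left,
    edgeDistSq, hq₀, hq₁, hr₀, hr₁, hV₀, hV₁]
  set σ := s - 1 / 2 - y * √3 / 6 with hσ
  set η := (1 - x) * √3 / 6 with hη
  have e₀ : (1 - s) * (1 / 2 + √3 / 6 * t₁ - t₀ / 2) + s * (1 / 2 + √3 / 6 * t₁ + t₀ / 2) -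
      (1 / 2 + √3 / 6 * (y * t₀ + x * t₁) + A₀) = σ * t₀ + η * t₁ - A₀ := by
    rw [hσ, hη]; ring
  have e₁ : (1 - s) * (√3 / 6 - √3 / 6 * t₀ - t₁ / 2) + s * (√3 / 6 - √3 / 6 * t₀ + t₁ / 2) -
      (√3 / 6 + √3 / 6 * (y * t₁ - x * t₀) + A₁) = σ * t₁ - η * t₀ - A₁ := by
    rw [hσ, hη]; ring
  rw [e₀, e₁]
  linear_combination (σ ^ 2 + η ^ 2 - A₀ ^ 2 - A₁ ^ 2) * ht

theorem frame_norm {t₀ t₁ u v S : ℝ} (ht : t₀ ^ 2 + t₁ ^ 2 = 1) (h : u ^ 2 + v ^ 2 = S) :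
    (u * t₀ + v * t₁) ^ 2 + (v * t₀ - u * t₁) ^ 2 = S := by
  linear_combination (u ^ 2 + v ^ 2) * ht + h

/-- An edge of the triangle meets either exactly two of the cells of an optimal triple, or all
three of them. -/
theorem edge_alternative_plane {t₀ t₁ x y S D : ℝ} {a b c q r V : Plane}
    (ht : t₀ ^ 2 + t₁ ^ 2 = 1)
    (hq₀ : q 0 = 1 / 2 + √3 / 6 * t₁ - t₀ / 2) (hq₁ : q 1 = √3 / 6 - √3 / 6 * t₀ - t₁ / 2)
    (hr₀ : r 0 = 1 / 2 + √3 / 6 * t₁ + t₀ / 2) (hr₁ : r 1 = √3 / 6 - √3 / 6 * t₀ + t₁ / 2)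
    (hV₀ : V 0 = 1 / 2 + √3 / 6 * (y * t₀ + x * t₁))
    (hV₁ : V 1 = √3 / 6 + √3 / 6 * (y * t₁ - x * t₀))
    (ha : (a 0 - V 0) ^ 2 + (a 1 - V 1) ^ 2 = S) (hb : (b 0 - V 0) ^ 2 + (b 1 - V 1) ^ 2 = S)
    (hc : (c 0 - V 0) ^ 2 + (c 1 - V 1) ^ 2 = S)
    (hD : D = 1 / 12 + (x ^ 2 + y ^ 2) / 12 - S) (hD' : D ≤ 11 / 432)
    (hab : distSq a q ≤ distSq b q) (hac : distSq a q ≤ distSq c q)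
    (hba : distSq b r ≤ distSq a r) (hbc : distSq b r ≤ distSq c r)
    (hE : ∫ s in (0:ℝ)..1, minDistSq a b c ((1 - s) • q + s • r) = 2 * D) :
    IsTwoCellEdge x y S
      ((a 0 - V 0) * t₀ + (a 1 - V 1) * t₁) ((a 1 - V 1) * t₀ - (a 0 - V 0) * t₁)
      ((b 0 - V 0) * t₀ + (b 1 - V 1) * t₁) ((b 1 - V 1) * t₀ - (b 0 - V 0) * t₁) ∨
      ((∃ s ∈ Set.Icc (0:ℝ) 1,
        (1 - s) * (distSq c q - distSq a q) + s * (distSq c r - distSq a r) < 0 ∧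
        (1 - s) * (distSq c q - distSq b q) + s * (distSq c r - distSq b r) < 0) ∧
      576 * x ^ 2 - 400 * x ≤ 1175 / 9 + 288 * (x ^ 2 + y ^ 2)) := by
  have hd : ∀ (e : Plane) (s : ℝ), distSq e ((1 - s) • q + s • r) = _ := fun e s =>
    distSq_edge (a := e) ht hq₀ hq₁ hr₀ hr₁ hV₀ hV₁ s
  have h0 : ∀ e : Plane, distSq e q =
      edgeDistSq x y ((e 0 - V 0) * t₀ + (e 1 - V 1) * t₁)
      ((e 1 - V 1) * t₀ - (e 0 - V 0) * t₁) 0 := fun e => by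
    have := hd e 0
    rwa [sub_zero, one_smul, zero_smul, add_zero] at this
  have h1 : ∀ e : Plane, distSq e r =
      edgeDistSq x y ((e 0 - V 0) * t₀ + (e 1 - V 1) * t₁)
      ((e 1 - V 1) * t₀ - (e 0 - V 0) * t₁) 1 := fun e => by
    have := hd e 1
    rwa [sub_self, one_smul, zero_smul, zero_add] at this
  simp only [minDistSq, hd] at hE
  have hab' := hab
  have hac' := hac
  have hba' := hba
  have hbc' := hbc
  rw [h0, h0] at hab' hac'
  rw [h1, h1] at hba' hbc'
  rcases edge_alternative (frame_norm ht ha) (frame_norm ht hb) (frame_norm ht hc) hD hD'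
    hab' hac' hba' hbc' hE with h | ⟨⟨s, hs, hsa, hsb⟩, h⟩
  · exact Or.inl h
  · refine Or.inr ⟨⟨s, hs, ?_, ?_⟩, h⟩
    · rw [← distSq_sub_lineMap, hd, hd]; linarith
    · rw [← distSq_sub_lineMap, hd, hd]; linarith

/-- The integral of the squared distance to a fixed point over an edge of length one. -/
theorem one_le_integral_edge {t₀ t₁ : ℝ} (ht : t₀ ^ 2 + t₁ ^ 2 = 1) {a q r : Plane}
    (h₀ : r 0 = q 0 + t₀) (h₁ : r 1 = q 1 + t₁) :
    1 / 12 ≤ ∫ s in (0:ℝ)..1, distSq a ((1 - s) • q + s • r) := by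
  have h : ∀ s : ℝ, distSq a ((1 - s) • q + s • r) = 1 * s ^ 2
      + (2 * ((q 0 - a 0) * t₀ + (q 1 - a 1) * t₁)) * s + ((q 0 - a 0) ^ 2 + (q 1 - a 1) ^ 2) := by
    intro s
    simp only [distSq, PiLp.add_apply, PiLp.smul_apply, smul_eq_mul, h₀, h₁]
    linear_combination s ^ 2 * ht
  simp only [h, integral_quadratic]
  have e : ((q 0 - a 0) ^ 2 + (q 1 - a 1) ^ 2) * (t₀ ^ 2 + t₁ ^ 2) =
      ((q 0 - a 0) * t₀ + (q 1 - a 1) * t₁) ^ 2 + ((q 0 - a 0) * t₁ - (q 1 - a 1) * t₀) ^ 2 := by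
    ring
  rw [ht] at e
  nlinarith [sq_nonneg ((q 0 - a 0) * t₀ + (q 1 - a 1) * t₁ + 1 / 2),
    sq_nonneg ((q 0 - a 0) * t₁ - (q 1 - a 1) * t₀)]

/-- If the endpoints of a unit segment have a common nearest point, the mean squared distance
over the segment is at least `1/12`. -/
theorem one_le_integral_edge_of_common {t₀ t₁ : ℝ} (ht : t₀ ^ 2 + t₁ ^ 2 = 1)
    {a b c e q r : Plane} (h₀ : r 0 = q 0 + t₀) (h₁ : r 1 = q 1 + t₁)
    (hq : distSq e q ≤ minDistSq a b c q) (hr : distSq e r ≤ minDistSq a b c r) :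
    1 / 12 ≤ ∫ s in (0:ℝ)..1, minDistSq a b c ((1 - s) • q + s • r) := by
  refine (one_le_integral_edge (a := e) ht h₀ h₁).trans ?_
  have hl : Continuous fun s : ℝ => (1 - s) • q + s • r := by fun_prop
  refine intervalIntegral.integral_mono_on zero_le_one
    (((continuous_distSq e).comp hl).intervalIntegrable _ _)
    (((continuous_minDistSq a b c).comp hl).intervalIntegrable _ _) fun s hs => ?_
  have hle : ∀ f, distSq e q ≤ distSq f q → distSq e r ≤ distSq f r →
      distSq e ((1 - s) • q + s • r) ≤ distSq f ((1 - s) • q + s • r) := by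
    intro f h1 h2
    have := distSq_sub_lineMap e f q r s
    nlinarith [mul_nonneg (sub_nonneg.2 hs.2) (sub_nonneg.2 h1),
      mul_nonneg hs.1 (sub_nonneg.2 h2)]
  exact le_min (hle a (hq.trans (minDistSq_le_left _ _ _ _)) (hr.trans (minDistSq_le_left _ _ _ _)))
    (le_min (hle b (hq.trans (minDistSq_le_mid _ _ _ _)) (hr.trans (minDistSq_le_mid _ _ _ _)))
      (hle c (hq.trans (minDistSq_le_right _ _ _ _)) (hr.trans (minDistSq_le_right _ _ _ _))))

theorem exists_circumcenter {a b c : Plane}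
    (h : (b 0 - a 0) * (c 1 - a 1) - (b 1 - a 1) * (c 0 - a 0) ≠ 0) :
    ∃ V : Plane, distSq b V = distSq a V ∧ distSq c V = distSq a V := by
  set u := b 0 - a 0 with hu
  set v := b 1 - a 1 with hv
  set z := c 0 - a 0 with hz
  set w := c 1 - a 1 with hw
  have hb₀ : b 0 = a 0 + u := by rw [hu]; ring
  have hb₁ : b 1 = a 1 + v := by rw [hv]; ring
  have hc₀ : c 0 = a 0 + z := by rw [hz]; ring
  have hc₁ : c 1 = a 1 + w := by rw [hw]; ring
  refine ⟨!₂[a 0 + ((u ^ 2 + v ^ 2) * w - (z ^ 2 + w ^ 2) * v) / (2 * (u * w - v * z)),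
    a 1 + ((z ^ 2 + w ^ 2) * u - (u ^ 2 + v ^ 2) * z) / (2 * (u * w - v * z))], ?_, ?_⟩
  · simp only [distSq, Matrix.cons_val_zero, Matrix.cons_val_one,
      Matrix.cons_val_fin_one, hb₀, hb₁]
    field_simp
    ring
  · simp only [distSq, Matrix.cons_val_zero, Matrix.cons_val_one,
      Matrix.cons_val_fin_one, hc₀, hc₁]
    field_simp
    ring

end Quantization

/-! ### Exclusion of three-cell edges, and the equality case -/

namespace Quantization

/-- No edge meets three cells. The unknowns `aO, …, cB` are the squared distances of the three
points to the vertices. -/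
theorem no_three_cell_edge {x₀ x₁ x₂ w aO aA aB bO bA bB cO cA cB : ℝ}
    (hsum : x₀ + x₁ + x₂ = 0) (hw : w = 2 / 3 * (x₀ ^ 2 + x₁ ^ 2 + x₂ ^ 2))
    (haO : aO ≤ cO) (hbA : bA ≤ cA) (hca : cB ≤ aB) (hcb : cB ≤ bB)
    (hVa : (1 - x₁) * (cO - aO) + (1 - x₂) * (cA - aA) + (1 - x₀) * (cB - aB) = 0)
    (hVb : (1 - x₁) * (cO - bO) + (1 - x₂) * (cA - bA) + (1 - x₀) * (cB - bB) = 0)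
    (h₀ : (∃ s ∈ Set.Icc (0:ℝ) 1, (1 - s) * (cO - aO) + s * (cA - aA) < 0 ∧
      (1 - s) * (cO - bO) + s * (cA - bA) < 0) ∧ 576 * x₀ ^ 2 - 400 * x₀ ≤ 1175 / 9 + 288 * w)
    (h₁ : 576 * x₁ ^ 2 - 400 * x₁ ≤ 75 + 208 * w ∨ ∃ s ∈ Set.Icc (0:ℝ) 1,
      (1 - s) * (aA - bA) + s * (aB - bB) < 0 ∧ (1 - s) * (aA - cA) + s * (aB - cB) < 0)
    (h₂ : 576 * x₂ ^ 2 - 400 * x₂ ≤ 75 + 208 * w ∨ ∃ s ∈ Set.Icc (0:ℝ) 1,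
      (1 - s) * (bB - cB) + s * (bO - cO) < 0 ∧ (1 - s) * (bB - aB) + s * (bO - aO) < 0) :
    False := by
  obtain ⟨⟨s, ⟨hs0, hs1⟩, ha, hb⟩, h₀⟩ := h₀
  have hA : cA - aA < 0 := by
    by_contra h
    nlinarith [mul_nonneg (sub_nonneg.2 hs1) (sub_nonneg.2 haO), mul_nonneg hs0 (not_lt.1 h)]
  have hO : cO - bO < 0 := by
    by_contra h
    nlinarith [mul_nonneg hs0 (sub_nonneg.2 hbA), mul_nonneg (sub_nonneg.2 hs1) (not_lt.1 h)]
  -- At both ends of AB the point a is farther than c, so a is never nearest there; likewise b on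
  -- BO. Hence the other two edges satisfy the two-cell bound.
  have h₁ : 576 * x₁ ^ 2 - 400 * x₁ ≤ 75 + 208 * w := by
    rcases h₁ with h | ⟨u, ⟨hu0, hu1⟩, -, h⟩
    · exact h
    · nlinarith [mul_nonneg (sub_nonneg.2 hu1) (show 0 ≤ aA - cA by linarith),
        mul_nonneg hu0 (sub_nonneg.2 hca)]
  have h₂ : 576 * x₂ ^ 2 - 400 * x₂ ≤ 75 + 208 * w := by
    rcases h₂ with h | ⟨u, ⟨hu0, hu1⟩, h, -⟩
    · exact h
    · nlinarith [mul_nonneg (sub_nonneg.2 hu1) (sub_nonneg.2 hcb),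
        mul_nonneg hu0 (show 0 ≤ bO - cO by linarith)]
  rcases circumcenter_location hs0 hs1 haO hbA hca hcb hVa hVb ha hb with h | ⟨h, h'⟩
  · exact no_three_cells_beyond_edge hsum hw h₀ h₁ h₂ h
  · exact no_three_cells_beyond_vertex hsum hw h₀ h h'

/-- The difference of two squared distances is an affine function of the point and vanishes at V.
The weights are three times the barycentric coordinates of V. -/
theorem distSq_sub_barycentric {a c V : Plane} {X Y : ℝ} (hV₀ : V 0 = 1 / 2 + √3 / 6 * Y)
    (hV₁ : V 1 = √3 / 6 - √3 / 6 * X) (h : distSq c V = distSq a V) :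
    (1 - (-X / 2 + √3 / 2 * Y)) * (distSq c vertexO - distSq a vertexO)
      + (1 - (-X / 2 - √3 / 2 * Y)) * (distSq c vertexA - distSq a vertexA)
      + (1 - X) * (distSq c vertexB - distSq a vertexB) = 0 := by
  simp only [distSq, hV₀, hV₁] at h
  simp [distSq, vertexO, vertexA, vertexB]
  linear_combination 3 * h

theorem frame_inscribed {t₀ t₁ a₁ a₂ b₁ b₂ S k : ℝ} (ht : t₀ ^ 2 + t₁ ^ 2 = 1)
    (h : (a₁ * b₁ + a₂ * b₂) * (1 + k ^ 2) = S * (k ^ 2 - 1) ∧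
      (a₁ * b₂ - a₂ * b₁) * (1 + k ^ 2) = 2 * k * S) :
    ((a₁ * t₀ + a₂ * t₁) * (b₁ * t₀ + b₂ * t₁) + (a₂ * t₀ - a₁ * t₁) * (b₂ * t₀ - b₁ * t₁))
        * (1 + k ^ 2) = S * (k ^ 2 - 1) ∧
      ((a₁ * t₀ + a₂ * t₁) * (b₂ * t₀ - b₁ * t₁) - (a₂ * t₀ - a₁ * t₁) * (b₁ * t₀ + b₂ * t₁))
        * (1 + k ^ 2) = 2 * k * S := by
  obtain ⟨h1, h2⟩ := h
  constructor
  · linear_combination (a₁ * b₁ + a₂ * b₂) * (1 + k ^ 2) * ht + h1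
  · linear_combination (a₁ * b₂ - a₂ * b₁) * (1 + k ^ 2) * ht + h2

/-- The coordinates of the three points relative to the centroid in the equality case. -/
theorem coords_of_equality {a₁ a₂ b₁ b₂ c₁ c₂ S k : ℝ} (hS : 0 < S) (hk : √3 * k = 1)
    (ha : a₁ ^ 2 + a₂ ^ 2 = S) (hb : b₁ ^ 2 + b₂ ^ 2 = S)
    (hab : (a₁ * b₁ + a₂ * b₂) * (1 + k ^ 2) = S * (k ^ 2 - 1) ∧
      (a₁ * b₂ - a₂ * b₁) * (1 + k ^ 2) = 2 * k * S)
    (hbc : (b₁ * c₁ + b₂ * c₂) * (1 + k ^ 2) = S * (k ^ 2 - 1) ∧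
      (b₁ * c₂ - b₂ * c₁) * (1 + k ^ 2) = 2 * k * S)
    (hbreak : edgeDistSq 0 0 a₁ a₂ (1 / 2) = edgeDistSq 0 0 b₁ b₂ (1 / 2))
    (hQ : 3 * S / 2 = -a₁ / 8 - √3 / 12 * a₂ + b₁ / 8 - √3 / 12 * b₂) :
    a₁ = -5 / 24 ∧ a₂ = -5 * √3 / 72 ∧ b₁ = 5 / 24 ∧ b₂ = -5 * √3 / 72 ∧ c₁ = 0 ∧
      c₂ = 5 * √3 / 36 := by
  have h3 : (√3 : ℝ) ^ 2 = 3 := Real.sq_sqrt (by norm_num)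
  have h30 : (0 : ℝ) < √3 := by positivity
  obtain rfl : k = √3 / 3 := by
    apply mul_left_cancel₀ h30.ne'
    linear_combination hk - h3 / 3
  have hab1 : a₁ * b₁ + a₂ * b₂ = -S / 2 := by
    linear_combination (3 / 4) * hab.1 + (S / 12 - (a₁ * b₁ + a₂ * b₂) / 12) * h3
  have hab2 : a₁ * b₂ - a₂ * b₁ = √3 / 2 * S := by
    linear_combination (3 / 4) * hab.2 - (a₁ * b₂ - a₂ * b₁) / 12 * h3
  have hbc1 : b₁ * c₁ + b₂ * c₂ = -S / 2 := by
    linear_combination (3 / 4) * hbc.1 + (S / 12 - (b₁ * c₁ + b₂ * c₂) / 12) * h3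
  have hbc2 : b₁ * c₂ - b₂ * c₁ = √3 / 2 * S := by
    linear_combination (3 / 4) * hbc.2 - (b₁ * c₂ - b₂ * c₁) / 12 * h3
  -- Equidistance from the midpoint of OA, which lies directly below the centroid.
  have h2 : b₂ = a₂ := by
    unfold edgeDistSq at hbreak
    apply mul_left_cancel₀ h30.ne'
    linear_combination 3 * (ha - hb - hbreak)
  subst h2
  have h1 : b₁ = -a₁ := by
    have : (b₁ - a₁) * (b₁ + a₁) = 0 := by linear_combination hb - ha
    rcases mul_eq_zero.1 this with h | h
    · have : b₁ = a₁ := by linarith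
      subst this
      linarith
    · linarith
  subst h1
  have hS' : S = 4 * b₂ ^ 2 := by linarith
  have hb0 : b₂ ≠ 0 := by
    rintro rfl
    rw [hS'] at hS
    norm_num at hS
  have ha1 : a₁ = √3 * b₂ := by
    apply mul_left_cancel₀ hb0
    linear_combination hab2 / 2 + √3 / 4 * hS'
  subst ha1
  -- The central angles of 120° fix the shape, and `hQ` fixes the size.
  have hb2 : b₂ = -5 * √3 / 72 := by
    apply mul_left_cancel₀ hb0
    linear_combination hQ / 6 - hS' / 4
  have hSv : S = 25 / 432 := by
    rw [hS', hb2]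
    linear_combination 100 / 5184 * h3
  rw [hSv] at hbc1 hbc2
  rw [hb2] at hbc1 hbc2 ⊢
  have hc1 : c₁ = 0 := by
    linear_combination (18 / 5) * hbc1 + (6 * √3 / 5) * hbc2 + (5 / 144 - c₁ / 3 - √3 / 12 * c₂) * h3
  refine ⟨by linear_combination (-5 / 72) * h3, rfl, by linear_combination (5 / 72) * h3, rfl,
    hc1, ?_⟩
  rw [hc1] at hbc2
  linear_combination (24 / 5) * hbc2 - c₂ / 3 * h3

end Quantization

/-! ### A labelled optimal triple -/

namespace Quantization

theorem eq_means_of_coords {a b c : Plane} (ha₀ : a 0 = 7 / 24) (ha₁ : a 1 = 7 * √3 / 72)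
    (hb₀ : b 0 = 17 / 24) (hb₁ : b 1 = 7 * √3 / 72) (hc₀ : c 0 = 1 / 2)
    (hc₁ : c 1 = 11 * √3 / 36) : a = meanP ∧ b = meanQ ∧ c = meanR := by
  have h3 : (√3 : ℝ) ^ 2 = 3 := Real.sq_sqrt (by norm_num)
  have hi : 7 / (24 * √3) = 7 * √3 / 72 := by field_simp; rw [h3]; norm_num
  have hj : 11 / (12 * √3) = 11 * √3 / 36 := by field_simp; rw [h3]; norm_num
  refine ⟨?_, ?_, ?_⟩ <;> ext i <;> fin_cases i
  · simp [meanP, ha₀]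
  · simp [meanP, ha₁, hi]
  · simp [meanQ, hb₀]
  · simp [meanQ, hb₁, hi]
  · simp [meanR, hc₀]
  · simp [meanR, hc₁, hj]

set_option maxHeartbeats 1000000 in
/-- An optimal triple, labelled by nearest vertices, consists of the three means. -/
theorem eq_means_of_labelled_minimizer {a b c : Plane}
    (hmin : ∀ a' b' c', meanDistSq a b c ≤ meanDistSq a' b' c')
    (hle : meanDistSq a b c ≤ 11 / 432)
    (hcr : (b 0 - a 0) * (c 1 - a 1) - (b 1 - a 1) * (c 0 - a 0) ≠ 0)
    (hOb : distSq a vertexO ≤ distSq b vertexO) (hOc : distSq a vertexO ≤ distSq c vertexO)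
    (hAa : distSq b vertexA ≤ distSq a vertexA) (hAc : distSq b vertexA ≤ distSq c vertexA)
    (hBa : distSq c vertexB ≤ distSq a vertexB) (hBb : distSq c vertexB ≤ distSq b vertexB) :
    a = meanP ∧ b = meanQ ∧ c = meanR := by
  have h3 : (√3 : ℝ) ^ 2 = 3 := Real.sq_sqrt (by norm_num)
  have h30 : (0 : ℝ) < √3 := by positivity
  obtain ⟨V, hVb, hVc⟩ := exists_circumcenter hcr
  obtain ⟨S, hSa⟩ : ∃ S, distSq a V = S := ⟨_, rfl⟩
  have hSb : distSq b V = S := hVb.trans hSa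
  have hSc : distSq c V = S := hVc.trans hSa
  have hD := meanDistSq_eq_of_circumcenter hmin hSa hSb hSc
  have hE₁ := edge_mean_eq_two_mul
    (fun φ hφ => integral_uniformTriangle_eq_coneMean_BOA hφ) hmin
  have hE₂ := edge_mean_eq_two_mul
    (fun φ hφ => integral_uniformTriangle_eq_coneMean_OAB hφ) hmin
  have hE₃ := edge_mean_eq_two_mul
    (fun φ hφ => integral_uniformTriangle_eq_coneMean_ABO hφ) hmin
  have hE₂' : ∫ s in (0:ℝ)..1, minDistSq b c a ((1 - s) • vertexA + s • vertexB) =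
      2 * meanDistSq a b c := by
    simpa only [minDistSq_rotate a b c] using hE₂
  have hE₃' : ∫ s in (0:ℝ)..1, minDistSq c a b ((1 - s) • vertexB + s • vertexO) =
      2 * meanDistSq a b c := by
    simpa only [minDistSq_rotate c a b] using hE₃
  set D := meanDistSq a b c with hDdef
  obtain ⟨X, hX⟩ : ∃ X, X = 1 - 2 * √3 * V 1 := ⟨_, rfl⟩
  obtain ⟨Y, hY⟩ : ∃ Y, Y = 2 * √3 * (V 0 - 1 / 2) := ⟨_, rfl⟩
  have hV₀ : V 0 = 1 / 2 + √3 / 6 * Y := by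
    rw [hY]; linear_combination (-(V 0 - 1 / 2) / 3) * h3
  have hV₁ : V 1 = √3 / 6 - √3 / 6 * X := by
    rw [hX]; linear_combination (-(V 1) / 3) * h3
  have hD' : D = 1 / 12 + (X ^ 2 + Y ^ 2) / 12 - S := by
    rw [hD, hV₀, hV₁]; linear_combination ((X ^ 2 + Y ^ 2) / 36) * h3
  have hS : 25 / 432 + (X ^ 2 + Y ^ 2) / 12 ≤ S := by linarith
  have na : (a 0 - V 0) ^ 2 + (a 1 - V 1) ^ 2 = S := by rw [← hSa, distSq]; ring
  have nb : (b 0 - V 0) ^ 2 + (b 1 - V 1) ^ 2 = S := by rw [← hSb, distSq]; ring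
  have nc : (c 0 - V 0) ^ 2 + (c 1 - V 1) ^ 2 = S := by rw [← hSc, distSq]; ring
  -- The coordinates of V in the frames of AB and BO, which are the frame of OA turned by 120° and
  -- 240°. The normals sum to 0, hence so do X, X₂, X₃.
  obtain ⟨X₂, hX₂⟩ : ∃ x, x = -X / 2 + √3 / 2 * Y := ⟨_, rfl⟩
  obtain ⟨Y₂, hY₂⟩ : ∃ x, x = -Y / 2 - √3 / 2 * X := ⟨_, rfl⟩
  obtain ⟨X₃, hX₃⟩ : ∃ x, x = -X / 2 - √3 / 2 * Y := ⟨_, rfl⟩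
  obtain ⟨Y₃, hY₃⟩ : ∃ x, x = -Y / 2 + √3 / 2 * X := ⟨_, rfl⟩
  have hw₂ : X₂ ^ 2 + Y₂ ^ 2 = X ^ 2 + Y ^ 2 := by
    rw [hX₂, hY₂]; linear_combination ((X ^ 2 + Y ^ 2) / 4) * h3
  have hw₃ : X₃ ^ 2 + Y₃ ^ 2 = X ^ 2 + Y ^ 2 := by
    rw [hX₃, hY₃]; linear_combination ((X ^ 2 + Y ^ 2) / 4) * h3
  have hsum : X + X₂ + X₃ = 0 := by rw [hX₂, hX₃]; ring
  have hw : X ^ 2 + Y ^ 2 = 2 / 3 * (X ^ 2 + X₂ ^ 2 + X₃ ^ 2) := by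
    rw [hX₂, hX₃]; linear_combination (-(Y ^ 2) / 3) * h3
  have hS₂ : 25 / 432 + (X₂ ^ 2 + Y₂ ^ 2) / 12 ≤ S := by rw [hw₂]; exact hS
  have hS₃ : 25 / 432 + (X₃ ^ 2 + Y₃ ^ 2) / 12 ≤ S := by rw [hw₃]; exact hS
  have t₁ : (1:ℝ) ^ 2 + 0 ^ 2 = 1 := by norm_num
  have t₂ : (-1 / 2 : ℝ) ^ 2 + (√3 / 2) ^ 2 = 1 := by linear_combination h3 / 4
  have t₃ : (-1 / 2 : ℝ) ^ 2 + (-√3 / 2) ^ 2 = 1 := by linear_combination h3 / 4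
  have O₀ : vertexO 0 = 0 := by simp [vertexO]
  have O₁ : vertexO 1 = 0 := by simp [vertexO]
  have A₀ : vertexA 0 = 1 := by simp [vertexA]
  have A₁ : vertexA 1 = 0 := by simp [vertexA]
  have B₀ : vertexB 0 = 1 / 2 := by simp [vertexB]
  have B₁ : vertexB 1 = √3 / 2 := by simp [vertexB]
  have alt₁ := edge_alternative_plane t₁ (q := vertexO) (r := vertexA) (x := X) (y := Y)
    (by rw [O₀]; ring) (by rw [O₁]; ring) (by rw [A₀]; ring) (by rw [A₁]; ring)
    (by rw [hV₀]; ring) (by rw [hV₁]; ring) na nb nc hD' hle hOb hOc hAa hAc hE₁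
  have alt₂ := edge_alternative_plane t₂ (q := vertexA) (r := vertexB) (x := X₂) (y := Y₂)
    (by rw [A₀]; linear_combination (-1 / 12) * h3) (by rw [A₁]; ring)
    (by rw [B₀]; linear_combination (-1 / 12) * h3) (by rw [B₁]; ring)
    (by rw [hV₀, hX₂, hY₂]; linear_combination (-√3 * Y / 24) * h3)
    (by rw [hV₁, hX₂, hY₂]; linear_combination (√3 * X / 24) * h3)
    nb nc na (by rw [hw₂]; exact hD') hle hAc hAa hBb hBa hE₂'
  have alt₃ := edge_alternative_plane t₃ (q := vertexB) (r := vertexO) (x := X₃) (y := Y₃)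
    (by rw [B₀]; linear_combination (1 / 12) * h3) (by rw [B₁]; ring)
    (by rw [O₀]; linear_combination (1 / 12) * h3) (by rw [O₁]; ring)
    (by rw [hV₀, hX₃, hY₃]; linear_combination (-√3 * Y / 24) * h3)
    (by rw [hV₁, hX₃, hY₃]; linear_combination (√3 * X / 24) * h3)
    nc na nb (by rw [hw₃]; exact hD') hle hBa hBb hOc hOb hE₃'
  rw [hw₂] at alt₂
  rw [hw₃] at alt₃
  have bary : ∀ e f : Plane, distSq e V = S → distSq f V = S →
      (1 - X₂) * (distSq f vertexO - distSq e vertexO)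
      + (1 - X₃) * (distSq f vertexA - distSq e vertexA)
      + (1 - X) * (distSq f vertexB - distSq e vertexB) = 0 := by
    intro e f he hf
    rw [hX₂, hX₃]
    exact distSq_sub_barycentric hV₀ hV₁ (hf.trans he.symm)
  have fr₁ := fun u v h => frame_norm (u := u) (v := v) (S := S) t₁ h
  have fr₂ := fun u v h => frame_norm (u := u) (v := v) (S := S) t₂ h
  have fr₃ := fun u v h => frame_norm (u := u) (v := v) (S := S) t₃ h
  have alt₁' := alt₁.imp (fun h => h.normal_coord_bound (fr₁ _ _ na) (fr₁ _ _ nb) hS) And.left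
  have alt₂' := alt₂.imp (fun h => hw₂ ▸ h.normal_coord_bound (fr₂ _ _ nb) (fr₂ _ _ nc) hS₂)
    And.left
  have alt₃' := alt₃.imp (fun h => hw₃ ▸ h.normal_coord_bound (fr₃ _ _ nc) (fr₃ _ _ na) hS₃)
    And.left
  -- The three exclusions are cyclic relabellings of one another.
  have two₁ := alt₁.resolve_right fun h => no_three_cell_edge hsum hw hOc hAc hBa hBb
    (bary a c hSa hSc) (bary b c hSb hSc) h alt₂' alt₃'
  have two₂ := alt₂.resolve_right fun h => no_three_cell_edge (x₀ := X₂) (x₁ := X₃) (x₂ := X)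
    (by linarith) (by linarith) hAa hBa hOb hOc
    (by linarith [bary b a hSb hSa]) (by linarith [bary c a hSc hSa]) h alt₃' alt₁'
  have two₃ := alt₃.resolve_right fun h => no_three_cell_edge (x₀ := X₃) (x₁ := X) (x₂ := X₂)
    (by linarith) (by linarith) hBb hOb hAc hAa
    (by linarith [bary c b hSc hSb]) (by linarith [bary a b hSa hSb]) h alt₁' alt₂'
  obtain ⟨δ₁, hδ₁, hz₁, hψ₁⟩ := two₁.exists_offset (fr₁ _ _ na) (fr₁ _ _ nb) hS
  obtain ⟨δ₂, hδ₂, -, hψ₂⟩ := two₂.exists_offset (fr₂ _ _ nb) (fr₂ _ _ nc) hS₂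
  obtain ⟨δ₃, hδ₃, -, hψ₃⟩ := two₃.exists_offset (fr₃ _ _ nc) (fr₃ _ _ na) hS₃
  obtain ⟨a₁, ha₁⟩ : ∃ z, z = a 0 - V 0 := ⟨_, rfl⟩
  obtain ⟨a₂, ha₂⟩ : ∃ z, z = a 1 - V 1 := ⟨_, rfl⟩
  obtain ⟨b₁, hb₁⟩ : ∃ z, z = b 0 - V 0 := ⟨_, rfl⟩
  obtain ⟨b₂, hb₂⟩ : ∃ z, z = b 1 - V 1 := ⟨_, rfl⟩
  obtain ⟨c₁, hc₁⟩ : ∃ z, z = c 0 - V 0 := ⟨_, rfl⟩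
  obtain ⟨c₂, hc₂⟩ : ∃ z, z = c 1 - V 1 := ⟨_, rfl⟩
  rw [← ha₁, ← ha₂] at na hψ₁ hψ₃ hz₁
  rw [← hb₁, ← hb₂] at nb hψ₁ hψ₂ hz₁
  rw [← hc₁, ← hc₂] at nc hψ₂ hψ₃
  obtain ⟨cr, hcrd⟩ : ∃ z, z = (a₁ - c₁) * (b₂ - c₂) - (a₂ - c₂) * (b₁ - c₁) := ⟨_, rfl⟩
  have hcr0 : cr ≠ 0 := by
    rw [hcrd, ha₁, ha₂, hb₁, hb₂, hc₁, hc₂]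
    convert hcr using 1
    ring
  have cr₂ : (b₁ - a₁) * (c₂ - a₂) - (b₂ - a₂) * (c₁ - a₁) = cr := by rw [hcrd]; ring
  have cr₃ : (c₁ - b₁) * (a₂ - b₂) - (c₂ - b₂) * (a₁ - b₁) = cr := by rw [hcrd]; ring
  -- The kᵢ are the cotangents of the angles of the triple at c, a and b, oriented by the sign of
  -- `cr`.
  obtain ⟨k₁, hk₁⟩ : ∃ k, (a₁ - c₁) * (b₁ - c₁) + (a₂ - c₂) * (b₂ - c₂) = k * cr :=
    ⟨_, (div_mul_cancel₀ _ hcr0).symm⟩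
  obtain ⟨k₂, hk₂⟩ : ∃ k, (b₁ - a₁) * (c₁ - a₁) + (b₂ - a₂) * (c₂ - a₂) = k * cr :=
    ⟨_, (div_mul_cancel₀ _ hcr0).symm⟩
  obtain ⟨k₃, hk₃⟩ : ∃ k, (c₁ - b₁) * (a₁ - b₁) + (c₂ - b₂) * (a₂ - b₂) = k * cr :=
    ⟨_, (div_mul_cancel₀ _ hcr0).symm⟩
  have hkk : k₁ * k₂ + k₂ * k₃ + k₃ * k₁ = 1 := by
    have : (k₁ * k₂ + k₂ * k₃ + k₃ * k₁) * (cr * cr) = 1 * (cr * cr) := by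
      calc _ = (k₁ * cr) * (k₂ * cr) + (k₂ * cr) * (k₃ * cr) + (k₃ * cr) * (k₁ * cr) := by ring
        _ = _ := by rw [← hk₁, ← hk₂, ← hk₃, hcrd]; ring
    exact mul_right_cancel₀ (mul_ne_zero hcr0 hcr0) this
  have ins₁ := inscribed_angle na nb nc (hcrd ▸ hcr0) (hcrd ▸ hk₁)
  have ins₂ := inscribed_angle nb nc na (cr₂.symm ▸ hcr0) (cr₂.symm ▸ hk₂)
  have ins₃ := inscribed_angle nc na nb (cr₃.symm ▸ hcr0) (cr₃.symm ▸ hk₃)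
  have q₁ := hψ₁ k₁ _ rfl (frame_inscribed t₁ ins₁).1 (frame_inscribed t₁ ins₁).2
  have q₂ := hψ₂ k₂ _ rfl (frame_inscribed t₂ ins₂).1 (frame_inscribed t₂ ins₂).2
  have q₃ := hψ₃ k₃ _ rfl (frame_inscribed t₃ ins₃).1 (frame_inscribed t₃ ins₃).2
  obtain ⟨x0, x20, κ₁, κ₂, d₁⟩ := circumcenter_eq_centroid hsum hw rfl hw₂ hw₃ hδ₁ hδ₂ hδ₃
    q₁ q₂ q₃ (by linear_combination 3 * hkk + (k₁ * k₂ + k₂ * k₃ + k₃ * k₁) * h3)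
  obtain rfl : Y = 0 := by
    rw [x0] at hX₂
    have : √3 * Y = 0 := by linarith
    exact (mul_eq_zero.1 this).resolve_left h30.ne'
  subst x0
  obtain ⟨hbreak, hQ⟩ := hz₁ d₁
  obtain rfl : k₂ = k₁ := mul_left_cancel₀ h30.ne' (κ₂.trans κ₁.symm)
  norm_num at hbreak hQ
  obtain ⟨r₁, r₂, r₃, r₄, r₅, r₆⟩ := coords_of_equality (by linarith) κ₁ na nb ins₁ ins₂
    (by simpa using hbreak) (by linear_combination hQ)
  exact eq_means_of_coords (by linarith) (by linarith) (by linarith) (by linarith) (by linarith)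
    (by linarith)

end Quantization

/-! ### From labelled triples to optimal sets -/

namespace Quantization

theorem meanDistSq_congr {a b c a' b' c' : Plane}
    (h : ∀ x, minDistSq a b c x = minDistSq a' b' c' x) : meanDistSq a b c = meanDistSq a' b' c' := by
  unfold meanDistSq
  simp only [h]

theorem meanDistSq_nonneg (a b c : Plane) : 0 ≤ meanDistSq a b c :=
  integral_nonneg (minDistSq_nonneg a b c)

/-- A point nearest to both ends of an edge is nearest along all of it. The edge mean 2D is then at
least 1/12, contradicting D ≤ 11/432. -/
theorem no_common_nearest {a b c : Plane}
    (hmin : ∀ a' b' c', meanDistSq a b c ≤ meanDistSq a' b' c') (hle : meanDistSq a b c ≤ 11 / 432)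
    (e : Plane) :
    ¬(distSq e vertexO ≤ minDistSq a b c vertexO ∧ distSq e vertexA ≤ minDistSq a b c vertexA) ∧
    ¬(distSq e vertexA ≤ minDistSq a b c vertexA ∧ distSq e vertexB ≤ minDistSq a b c vertexB) ∧
    ¬(distSq e vertexB ≤ minDistSq a b c vertexB ∧ distSq e vertexO ≤ minDistSq a b c vertexO) := by
  have h3 : (√3 : ℝ) ^ 2 = 3 := Real.sq_sqrt (by norm_num)
  refine ⟨fun ⟨h1, h2⟩ => ?_, fun ⟨h1, h2⟩ => ?_, fun ⟨h1, h2⟩ => ?_⟩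
  · have hE := edge_mean_eq_two_mul
      (fun φ hφ => integral_uniformTriangle_eq_coneMean_BOA hφ) hmin
    have := one_le_integral_edge_of_common (t₀ := 1) (t₁ := 0) (by norm_num)
      (by simp [vertexO, vertexA]) (by simp [vertexO, vertexA]) h1 h2
    linarith
  · have hE := edge_mean_eq_two_mul
      (fun φ hφ => integral_uniformTriangle_eq_coneMean_OAB hφ) hmin
    have := one_le_integral_edge_of_common (t₀ := -1 / 2) (t₁ := √3 / 2)
      (by linear_combination h3 / 4)
      (by simp [vertexA, vertexB]; norm_num) (by simp [vertexA, vertexB]) h1 h2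
    linarith
  · have hE := edge_mean_eq_two_mul
      (fun φ hφ => integral_uniformTriangle_eq_coneMean_ABO hφ) hmin
    have := one_le_integral_edge_of_common (t₀ := -1 / 2) (t₁ := -√3 / 2)
      (by linear_combination h3 / 4)
      (by simp [vertexB, vertexO]; norm_num) (by simp [vertexB, vertexO]; ring) h1 h2
    linarith

theorem triple_eq_means_of_nearest {a b c : Plane}
    (hmin : ∀ a' b' c', meanDistSq a b c ≤ meanDistSq a' b' c') (hle : meanDistSq a b c ≤ 11 / 432)
    (hO : minDistSq a b c vertexO = distSq a vertexO)
    (hA : minDistSq a b c vertexA = distSq b vertexA)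
    (hB : minDistSq a b c vertexB = distSq c vertexB) :
    a = meanP ∧ b = meanQ ∧ c = meanR := by
  refine eq_means_of_labelled_minimizer hmin hle ?_ (hO ▸ minDistSq_le_mid a b c _)
    (hO ▸ minDistSq_le_right a b c _) (hA ▸ minDistSq_le_left a b c _)
    (hA ▸ minDistSq_le_right a b c _) (hB ▸ minDistSq_le_left a b c _)
    (hB ▸ minDistSq_le_mid a b c _)
  intro hcr
  by_cases hab : (b 1 - a 1) ^ 2 + (b 0 - a 0) ^ 2 = 0
  · have h1 : b 1 = a 1 := by nlinarith [sq_nonneg (b 0 - a 0)]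
    have h0 : b 0 = a 0 := by nlinarith [sq_nonneg (b 1 - a 1)]
    obtain rfl : b = a := by ext i; fin_cases i <;> simpa
    exact (no_common_nearest hmin hle b).1 ⟨hO.ge, hA.ge⟩
  · have := one_le_meanDistSq_of_collinear (a := a) (b := b) (c := c) (α := b 1 - a 1)
      (β := -(b 0 - a 0)) (γ := -((b 1 - a 1) * a 0) + (b 0 - a 0) * a 1)
      (by rwa [neg_sq]) (by ring) (by ring) (by linear_combination -hcr)
    linarith

theorem minDistSq_eq_or (a b c x : Plane) : minDistSq a b c x = distSq a x ∨
    minDistSq a b c x = distSq b x ∨ minDistSq a b c x = distSq c x := by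
  unfold minDistSq
  rcases min_choice (distSq a x) (min (distSq b x) (distSq c x)) with h | h
  · exact Or.inl h
  · rw [h]
    exact Or.inr (min_choice _ _)

/-- The only minimising triple, up to order, consists of the three means. -/
theorem triple_eq_means {a b c : Plane}
    (hmin : ∀ a' b' c', meanDistSq a b c ≤ meanDistSq a' b' c') :
    ({a, b, c} : Set Plane) = {meanP, meanQ, meanR} := by
  have hle : meanDistSq a b c ≤ 11 / 432 := (hmin _ _ _).trans meanDistSq_means_le
  have key : ∀ a' b' c', (∀ x, minDistSq a' b' c' x = minDistSq a b c x) →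
      minDistSq a b c vertexO = distSq a' vertexO → minDistSq a b c vertexA = distSq b' vertexA →
      minDistSq a b c vertexB = distSq c' vertexB → a' = meanP ∧ b' = meanQ ∧ c' = meanR := by
    intro a' b' c' h hO hA hB
    have hm := meanDistSq_congr h
    exact triple_eq_means_of_nearest (by rwa [hm]) (by rwa [hm]) ((h _).trans hO)
      ((h _).trans hA) ((h _).trans hB)
  -- Of the 27 assignments of nearest points to vertices only the six bijections survive, and each
  -- is a relabelling of the triple.
  have hno := no_common_nearest hmin hle
  rcases minDistSq_eq_or a b c vertexO with hO | hO | hO <;>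
  rcases minDistSq_eq_or a b c vertexA with hA | hA | hA <;>
  first
  | exact ((hno _).1 ⟨hO.ge, hA.ge⟩).elim
  | rcases minDistSq_eq_or a b c vertexB with hB | hB | hB <;>
    first
    | exact ((hno _).2.1 ⟨hA.ge, hB.ge⟩).elim
    | exact ((hno _).2.2 ⟨hB.ge, hO.ge⟩).elim
    | (obtain ⟨rfl, rfl, rfl⟩ := key _ _ _
        (fun x => by simp only [minDistSq, min_comm, min_left_comm, min_assoc]) hO hA hB
       ext x
       simp only [Set.mem_insert_iff, Set.mem_singleton_iff] <;> tauto)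

/-- A minimiser exists and has the three means as its underlying set. The distortion depends on this
set only, so the means themselves are minimal. -/
theorem meanDistSq_means_le_all (a b c : Plane) :
    meanDistSq meanP meanQ meanR ≤ meanDistSq a b c := by
  obtain ⟨a', b', c', hmin⟩ := exists_minimizer
  have h := distortion_triple a' b' c'
  rw [triple_eq_means hmin, distortion_triple, ENNReal.ofReal_eq_ofReal_iff
    (meanDistSq_nonneg _ _ _) (meanDistSq_nonneg _ _ _)] at h
  rw [h]
  exact hmin a b c

/-- Optimality is already known, so the circumcentre identity at the centroid gives 1/12 - 25/432
without integration. -/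
theorem meanDistSq_means : meanDistSq meanP meanQ meanR = 11 / 432 := by
  have h3 : (√3 : ℝ) ^ 2 = 3 := Real.sq_sqrt (by norm_num)
  have hi : 7 / (24 * √3) = 7 * √3 / 72 := by field_simp; rw [h3]; norm_num
  have hj : 11 / (12 * √3) = 11 * √3 / 36 := by field_simp; rw [h3]; norm_num
  rw [meanDistSq_eq_of_circumcenter (V := !₂[1 / 2, √3 / 6]) (S := 25 / 432)
    meanDistSq_means_le_all]
  · simp; norm_num
  · simp [distSq, meanP, hi]; linear_combination (25 / 5184) * h3
  · simp [distSq, meanQ, hi]; linear_combination (25 / 5184) * h3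
  · simp [distSq, meanR, hj]; linear_combination (25 / 1296) * h3

theorem encard_means_le : ({meanP, meanQ, meanR} : Set Plane).encard ≤ (3 : ℕ) := by
  refine (Set.encard_insert_le _ _).trans ?_
  refine (add_le_add_left (Set.encard_insert_le _ _) 1).trans ?_
  rw [Set.encard_singleton]
  norm_num

theorem ofReal_error : ENNReal.ofReal (11 / 432) = 11 / 432 := by
  rw [ENNReal.ofReal_div_of_pos (by norm_num)]
  norm_num

theorem distortion_means : distortion uniformTriangle {meanP, meanQ, meanR} = 11 / 432 := by
  rw [distortion_triple, meanDistSq_means, ofReal_error]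

theorem quantizationError_three : quantizationError uniformTriangle 3 = 11 / 432 := by
  refine le_antisymm ?_ ?_
  · rw [← distortion_means]
    unfold quantizationError
    exact iInf₂_le_of_le {meanP, meanQ, meanR} encard_means_le le_rfl
  · refine le_iInf₂ fun α hα => ?_
    rcases α.eq_empty_or_nonempty with rfl | hne
    · rw [distortion_empty]; exact le_top
    · obtain ⟨a, b, c, rfl⟩ := exists_eq_triple hne hα
      rw [distortion_triple, ← distortion_means, distortion_triple]
      exact ENNReal.ofReal_le_ofReal (meanDistSq_means_le_all a b c)

theorem isOptimalSetOfMeans_three_iff (α : Set Plane) :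
    IsOptimalSetOfMeans uniformTriangle 3 α ↔ α = {meanP, meanQ, meanR} := by
  constructor
  · rintro ⟨hα, h⟩
    rw [quantizationError_three] at h
    rcases α.eq_empty_or_nonempty with rfl | hne
    · rw [distortion_empty, ← ofReal_error] at h
      exact absurd h.symm ENNReal.ofReal_ne_top
    · obtain ⟨a, b, c, rfl⟩ := exists_eq_triple hne hα
      rw [← distortion_means, distortion_triple, distortion_triple,
        ENNReal.ofReal_eq_ofReal_iff (meanDistSq_nonneg _ _ _)
          (meanDistSq_nonneg _ _ _)] at h
      exact triple_eq_means fun a' b' c' => h ▸ meanDistSq_means_le_all a' b' c'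
  · rintro rfl
    exact ⟨encard_means_le, by rw [distortion_means, quantizationError_three]⟩

theorem parallel_of_vsub_eq_smul {p q r s : Plane} {k : ℝ} (hk : k ≠ 0)
    (h : p - q = k • (r - s)) : line[ℝ, p, q] ∥ line[ℝ, r, s] := by
  rw [AffineSubspace.affineSpan_pair_parallel_iff_vectorSpan_eq, vectorSpan_pair,
    vectorSpan_pair, vsub_eq_sub, vsub_eq_sub, h,
    Submodule.span_singleton_smul_eq hk.isUnit]

theorem affineIndependent_means : AffineIndependent ℝ ![meanP, meanQ, meanR] := by
  rw [affineIndependent_iff_not_collinear_set, collinear_iff_of_mem (p₀ := meanP) (by simp)]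
  rintro ⟨v, hv⟩
  obtain ⟨s, hs⟩ := hv meanQ (by simp)
  obtain ⟨t, ht⟩ := hv meanR (by simp)
  have h30 : (0 : ℝ) < √3 := by positivity
  have s0 := congrArg (fun z : Plane => z 0) hs
  have s1 := congrArg (fun z : Plane => z 1) hs
  have t1 := congrArg (fun z : Plane => z 1) ht
  simp [meanP, meanQ, meanR] at s0 s1 t1
  rcases s1 with h | h
  · rw [h] at s0; norm_num at s0
  · rw [h] at t1
    field_simp at t1
    norm_num at t1

end Quantization

theorem theorem4p1 :
    (∀ α : Set Quantization.Plane,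
      Quantization.IsOptimalSetOfMeans Quantization.uniformTriangle 3 α ↔
        α = {Quantization.meanP, Quantization.meanQ, Quantization.meanR}) ∧
    (∃ t : Affine.Triangle ℝ Quantization.Plane,
      t.points = ![Quantization.meanP, Quantization.meanQ, Quantization.meanR] ∧
        t.Equilateral) ∧
    line[ℝ, Quantization.meanP, Quantization.meanQ] ∥
      line[ℝ, Quantization.vertexO, Quantization.vertexA] ∧
    line[ℝ, Quantization.meanQ, Quantization.meanR] ∥
      line[ℝ, Quantization.vertexA, Quantization.vertexB] ∧
    line[ℝ, Quantization.meanR, Quantization.meanP] ∥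
      line[ℝ, Quantization.vertexB, Quantization.vertexO] ∧
    Quantization.quantizationError Quantization.uniformTriangle 3 = 11 / 432 := by
  have h3 : (√3 : ℝ) ^ 2 = 3 := Real.sq_sqrt (by norm_num)
  have hi : 7 / (24 * √3) = 7 * √3 / 72 := by field_simp; rw [h3]; norm_num
  have hj : 11 / (12 * √3) = 11 * √3 / 36 := by field_simp; rw [h3]; norm_num
  refine ⟨Quantization.isOptimalSetOfMeans_three_iff,
    ⟨⟨_, Quantization.affineIndependent_means⟩, rfl, ?_⟩, ?_, ?_, ?_,
    Quantization.quantizationError_three⟩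
  · rw [Affine.Triangle.equilateral_iff_dist_01_eq_02_and_dist_01_eq_12]
    constructor <;>
    · simp only [Matrix.cons_val_zero, Matrix.cons_val_one, Matrix.cons_val, dist_eq_norm]
      rw [← sq_eq_sq₀ (norm_nonneg _) (norm_nonneg _), Quantization.norm_sub_sq_eq_distSq,
        Quantization.norm_sub_sq_eq_distSq]
      simp [Quantization.distSq, Quantization.meanP, Quantization.meanQ, Quantization.meanR, hi, hj]
      linear_combination (-25 / 576) * h3
  · refine Quantization.parallel_of_vsub_eq_smul (k := 5 / 12) (by norm_num) ?_
    ext i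
    fin_cases i <;>
      simp [Quantization.meanP, Quantization.meanQ, Quantization.vertexO, Quantization.vertexA]
    norm_num
  · refine Quantization.parallel_of_vsub_eq_smul (k := 5 / 12) (by norm_num) ?_
    ext i
    fin_cases i <;>
      simp [Quantization.meanQ, Quantization.meanR, Quantization.vertexA, Quantization.vertexB,
        hi, hj]
    · norm_num
    · ring
  · refine Quantization.parallel_of_vsub_eq_smul (k := 5 / 12) (by norm_num) ?_
    ext i
    fin_cases i <;>
      simp [Quantization.meanR, Quantization.meanP, Quantization.vertexB, Quantization.vertexO,
        hi, hj]
    · norm_num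
    · ring
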